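/- Let $n\ge 1$ be an integer and let $a\in(0,1]$, $\alpha,s\in(0,1)$, $\gamma\le 0$, $p,q\in[1,\infty)$ and $\tau\in(0,\infty)$ be real numbers with $sp<n$. Put $p_s^*:=\frac{np}{n-sp}$ and assume $$\frac1\tau+\frac{\gamma}{n}=\frac{a}{p_s^*}+\frac{1-a}{q},\qquad\text{and}\qquad \gamma\ge -as\ \text{ if } a=1 \text{ or } q=p_s^*.$$ Then there is a constant $C$, depending only on $a,n,\alpha,s,\gamma,p,q,\tau$, such that for every open convex set $\Omega\subset\mathbb R^{n+1}$ and every $u\in W^{s,p}(\partial\Omega)$ $$\big\||x|^\gamma u\big\|_{L^\tau(\partial\Omega)}\le C\left(\frac12\int_{\partial\Omega}\int_{\partial\Omega}\frac{|u(x)-u(y)|^p}{|x-y|^{n+sp}}\,dx\,dy+\int_{\partial\Omega}H_\alpha(x)^{\frac{sp}{\alpha}}|u(x)|^p\,dx\right)^{\frac ap}\|u\|_{L^q(\partial\Omega)}^{1-a}.$$ Here integrals over $\partial\Omega$ and the norms $\|f\|_{L^r(\partial\Omega)}=(\int_{\partial\Omega}|f|^r\,dx)^{1/r}$ are taken with respect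 to the $n$-dimensional Hausdorff measure (normalized to agree with Lebesgue measure on $\mathbb R^n$), $|\cdot|$ is the Euclidean norm of $\mathbb R^{n+1}$, $W^{s,p}(\partial\Omega)$ is the set of real-valued $u\in L^p(\partial\Omega)$ for which the double integral above is finite, and $$H_\alpha(x)=\frac\alpha2\lim_{\varepsilon\downarrow0}\int_{\{|y-x|>\varepsilon\}}\frac{\chi_{\mathbb R^{n+1}\setminus\Omega}(y)-\chi_\Omega(y)}{|y-x|^{n+1+\alpha}}\,dy\in[0,\infty],\qquad x\in\partial\Omega,$$ is the nonlocal $\alpha$-mean curvature of $\Omega$. Both sides of the inequality may be $+\infty$; $0\cdot\infty=0$, and the last factor is $1$ when $a=1$. -/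

import Mathlib

open MeasureTheory Filter Topology Set
open scoped ENNReal

noncomputable section

/-- The surface measure on the boundary of `Ω ⊆ ℝⁿ⁺¹`: the `n`-dimensional Hausdorff measure,
normalized so that it is Lebesgue measure on `ℝⁿ`, restricted to `∂Ω`. -/
def boundaryMeasure {n : ℕ} (Ω : Set (EuclideanSpace ℝ (Fin (n + 1)))) :
    Measure (EuclideanSpace ℝ (Fin (n + 1))) :=
  (Measure.euclideanHausdorffMeasure n).restrict (frontier Ω)

/-- `(α / 2) ∫_{|y - x| > ε} (χ_{Ωᶜ}(y) - χ_Ω(y)) / |y - x|^(n + 1 + α) dy`. -/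
def truncatedMeanCurvature {n : ℕ} (Ω : Set (EuclideanSpace ℝ (Fin (n + 1)))) (α ε : ℝ)
    (x : EuclideanSpace ℝ (Fin (n + 1))) : ℝ :=
  α / 2 * ∫ y in {y | ε < ‖y - x‖},
    (Ωᶜ.indicator (fun _ => (1 : ℝ)) y - Ω.indicator (fun _ => (1 : ℝ)) y) /
      ‖y - x‖ ^ ((n : ℝ) + 1 + α)

/-- The nonlocal (fractional) `α`-mean curvature of `Ω` at `x`: the principal value, i.e. the limit
of the truncated integrals as `ε ↓ 0`, taken in the extended reals. -/
def nonlocalMeanCurvature {n : ℕ} (Ω : Set (EuclideanSpace ℝ (Fin (n + 1)))) (α : ℝ)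
    (x : EuclideanSpace ℝ (Fin (n + 1))) : EReal :=
  limUnder (𝓝[>] (0 : ℝ)) fun ε : ℝ => (truncatedMeanCurvature Ω α ε x : EReal)

/-- The truncated integrals are integrals of integrable functions. -/
theorem integrableOn_truncatedKernel {n : ℕ} {Ω : Set (EuclideanSpace ℝ (Fin (n + 1)))}
    (hΩ : IsOpen Ω) {α ε : ℝ} (hα : 0 < α) (hε : 0 < ε) (x : EuclideanSpace ℝ (Fin (n + 1))) :
    IntegrableOn (fun y => (Ωᶜ.indicator (fun _ => (1 : ℝ)) y - Ω.indicator (fun _ => (1 : ℝ)) y) /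
      ‖y - x‖ ^ ((n : ℝ) + 1 + α)) {y | ε < ‖y - x‖} := by
  have hr : (0 : ℝ) < (n : ℝ) + 1 + α := by positivity
  have h1 : Integrable
      (fun y : EuclideanSpace ℝ (Fin (n + 1)) => (1 + ‖y - x‖) ^ (-((n : ℝ) + 1 + α))) := by
    have := integrable_one_add_norm (E := EuclideanSpace ℝ (Fin (n + 1)))
      (μ := volume) (r := (n : ℝ) + 1 + α) (by simp; linarith)
    exact this.comp_sub_right x
  have hS : MeasurableSet {y : EuclideanSpace ℝ (Fin (n + 1)) | ε < ‖y - x‖} :=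
    measurableSet_lt measurable_const (by fun_prop)
  refine Integrable.mono' ((h1.const_mul ((1 / ε + 1) ^ ((n : ℝ) + 1 + α))).integrableOn) ?_ ?_
  · refine Measurable.aestronglyMeasurable ?_
    refine Measurable.div ?_ (by fun_prop)
    exact (measurable_const.indicator hΩ.measurableSet.compl).sub
      (measurable_const.indicator hΩ.measurableSet)
  · refine (ae_restrict_iff' hS).2 (Eventually.of_forall fun y hy => ?_)
    have hy' : ε < ‖y - x‖ := hy
    have hpos : 0 < ‖y - x‖ := hε.trans hy'
    have hnum : ‖Ωᶜ.indicator (fun _ => (1 : ℝ)) y - Ω.indicator (fun _ => (1 : ℝ)) y‖ = 1 := by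
      by_cases h : y ∈ Ω <;> simp [h]
    rw [norm_div, hnum, Real.norm_of_nonneg (by positivity), Real.rpow_neg (by positivity),
      ← div_eq_mul_inv, div_le_div_iff₀ (by positivity) (by positivity), one_mul,
      ← Real.mul_rpow (by positivity) (by positivity)]
    refine Real.rpow_le_rpow (by positivity) ?_ hr.le
    have : 1 ≤ 1 / ε * ‖y - x‖ := by
      rw [one_div, inv_mul_eq_div, le_div_iff₀ hε]; linarith
    linarith

/-- By convexity, the kernel has nonnegative integral over sets symmetric about a boundary point. -/
theorem setIntegral_kernel_nonneg {n : ℕ} {Ω : Set (EuclideanSpace ℝ (Fin (n + 1)))}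
    (hΩ : IsOpen Ω) (hc : Convex ℝ Ω) {α ε : ℝ} (hα : 0 < α) (hε : 0 < ε)
    {x : EuclideanSpace ℝ (Fin (n + 1))} (hx : x ∈ frontier Ω)
    {S : Set (EuclideanSpace ℝ (Fin (n + 1)))} (hS : MeasurableSet S)
    (hSε : S ⊆ {y | ε < ‖y - x‖}) (hsymm : ∀ y, x + x - y ∈ S ↔ y ∈ S) :
    0 ≤ ∫ y in S, (Ωᶜ.indicator (fun _ => (1 : ℝ)) y - Ω.indicator (fun _ => (1 : ℝ)) y) /
      ‖y - x‖ ^ ((n : ℝ) + 1 + α) := by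
  have hxΩ : x ∉ Ω := by
    rw [hΩ.frontier_eq] at hx
    exact hx.2
  set K : EuclideanSpace ℝ (Fin (n + 1)) → ℝ := fun y =>
    (Ωᶜ.indicator (fun _ => (1 : ℝ)) y - Ω.indicator (fun _ => (1 : ℝ)) y) /
      ‖y - x‖ ^ ((n : ℝ) + 1 + α) with hK
  have hint : Integrable (S.indicator K) :=
    (integrable_indicator_iff hS).2 ((integrableOn_truncatedKernel hΩ hα hε x).mono_set hSε)
  rw [← integral_indicator hS]
  have h1 : ∫ y, S.indicator K (x + x - y) = ∫ y, S.indicator K y :=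
    integral_sub_left_eq_self _ volume (x + x)
  have h2 : 0 ≤ ∫ y, (S.indicator K (x + x - y) + S.indicator K y) := by
    refine integral_nonneg fun y => ?_
    by_cases hy : y ∈ S
    · have hn : ‖x + x - y - x‖ = ‖y - x‖ := by
        rw [← norm_neg]; congr 1; abel
      have hnot : ¬ (y ∈ Ω ∧ x + x - y ∈ Ω) := fun h => hxΩ <| by
        have := hc h.1 h.2 (a := 1 / 2) (b := 1 / 2) (by norm_num) (by norm_num) (by norm_num)
        convert this using 1
        rw [← smul_add, add_sub_cancel, ← two_smul ℝ x, smul_smul]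
        norm_num
      simp only [Pi.zero_apply, indicator_of_mem hy, indicator_of_mem ((hsymm y).2 hy), hK, hn]
      rw [← add_div]
      refine div_nonneg ?_ (by positivity)
      by_cases h : y ∈ Ω <;> by_cases h' : x + x - y ∈ Ω <;> simp [h, h']
      exact (hnot ⟨h, h'⟩).elim
    · simp [hy, hsymm]
  rw [integral_add (hint.comp_sub_left (x + x)) hint, h1] at h2
  linarith

/-- For an open convex set the principal value exists in `[0, ∞]` at every boundary point. -/
theorem nonlocalMeanCurvature_spec {n : ℕ} {Ω : Set (EuclideanSpace ℝ (Fin (n + 1)))}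
    (hΩ : IsOpen Ω) (hc : Convex ℝ Ω) {α : ℝ} (hα : 0 < α)
    {x : EuclideanSpace ℝ (Fin (n + 1))} (hx : x ∈ frontier Ω) :
    0 ≤ nonlocalMeanCurvature Ω α x ∧
      Tendsto (fun ε : ℝ => (truncatedMeanCurvature Ω α ε x : EReal)) (𝓝[>] 0)
        (𝓝 (nonlocalMeanCurvature Ω α x)) := by
  have hmeas : ∀ ε : ℝ, MeasurableSet {y : EuclideanSpace ℝ (Fin (n + 1)) | ε < ‖y - x‖} :=
    fun ε => measurableSet_lt measurable_const (by fun_prop)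
  have hn : ∀ y, ‖x + x - y - x‖ = ‖y - x‖ := fun y => by
    rw [← norm_neg]; congr 1; abel
  have hpos : ∀ ε : ℝ, 0 < ε → 0 ≤ truncatedMeanCurvature Ω α ε x := fun ε hε =>
    mul_nonneg (by positivity) <| setIntegral_kernel_nonneg hΩ hc hα hε hx (hmeas ε) subset_rfl
      fun y => by simp only [mem_ofPred_eq, hn]
  have hanti : AntitoneOn (fun ε : ℝ => (truncatedMeanCurvature Ω α ε x : EReal)) (Ioi 0) := by
    intro ε hε δ hδ h
    have hsub : {y : EuclideanSpace ℝ (Fin (n + 1)) | δ < ‖y - x‖} ⊆ {y | ε < ‖y - x‖} :=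
      fun y hy => lt_of_le_of_lt h hy
    have h0 := setIntegral_kernel_nonneg hΩ hc hα hε hx ((hmeas ε).diff (hmeas δ)) sdiff_subset
      fun y => by simp only [Set.mem_sdiff, mem_ofPred_eq, hn]
    rw [setIntegral_sdiff (hmeas δ) (integrableOn_truncatedKernel hΩ hα hε x) hsub] at h0
    refine EReal.coe_le_coe_iff.2 (mul_le_mul_of_nonneg_left ?_ (by positivity))
    linarith
  have hlim := AntitoneOn.tendsto_nhdsGT hanti (OrderTop.bddAbove _)
  have heq : nonlocalMeanCurvature Ω α x = _ := hlim.limUnder_eq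
  rw [heq]
  refine ⟨?_, hlim⟩
  refine ge_of_tendsto hlim (eventually_nhdsWithin_of_forall fun ε hε => ?_)
  exact_mod_cast hpos ε hε

/-- `[u]^p_{W^{s,p}(∂Ω)} = ∫_{∂Ω} ∫_{∂Ω} |u(x) - u(y)|^p / |x - y|^(n + s p) dx dy`, where `|x - y|`
is the Euclidean distance of the ambient space. -/
def gagliardoEnergy {n : ℕ} (Ω : Set (EuclideanSpace ℝ (Fin (n + 1)))) (s p : ℝ)
    (u : EuclideanSpace ℝ (Fin (n + 1)) → ℝ) : ℝ≥0∞ :=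
  ∫⁻ x, ∫⁻ y, ENNReal.ofReal (|u x - u y| ^ p / ‖x - y‖ ^ ((n : ℝ) + s * p))
    ∂(boundaryMeasure Ω) ∂(boundaryMeasure Ω)

/-- `∫_{∂Ω} H_α(x)^(s p / α) |u(x)|^p dx`. For convex `Ω` the curvature `H_α` takes values in
`[0, ∞]` on `∂Ω`, so that passing to `ℝ≥0∞` loses nothing. -/
def curvatureEnergy {n : ℕ} (Ω : Set (EuclideanSpace ℝ (Fin (n + 1)))) (α s p : ℝ)
    (u : EuclideanSpace ℝ (Fin (n + 1)) → ℝ) : ℝ≥0∞ :=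
  ∫⁻ x, (nonlocalMeanCurvature Ω α x).toENNReal ^ (s * p / α) * ENNReal.ofReal (|u x| ^ p)
    ∂(boundaryMeasure Ω)

/-- The fractional Sobolev space `W^{s,p}(∂Ω)`: functions in `L^p(∂Ω)` with finite seminorm.
Functions on `∂Ω` are given by functions on the ambient space; only their values on `∂Ω` matter. -/
def MemFractionalSobolev {n : ℕ} (Ω : Set (EuclideanSpace ℝ (Fin (n + 1)))) (s p : ℝ)
    (u : EuclideanSpace ℝ (Fin (n + 1)) → ℝ) : Prop :=
  MemLp u (ENNReal.ofReal p) (boundaryMeasure Ω) ∧ gagliardoEnergy Ω s p u < ∞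

end

/-!
The proof reduces every case to one geometric estimate for convex hypersurfaces and then argues with
level sets.

*Geometry.* At a boundary point `x`, a supporting hyperplane puts `Ω` below a cone of slope `n`
around some coordinate axis. Over the points with a common axis, `∂Ω` is a Lipschitz graph, whence
`|∂Ω ∩ B_R(0)| ≤ A Rⁿ` (`exists_boundaryMeasure_ball_le`). Following the axis out of `Ω` shows that
the shadow of `Ω` near `x` is contained in that of `∂Ω`, whence `|Ω ∩ B_R(x)| ≤ 2 R |∂Ω ∩ B_{(n + 2)
R}(x)|` (`volume_inter_ball_le`). So if `∂Ω` has little area in a ball about `x`, then `Ω` fills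
little of that ball, and `H_α(x) ≥ c R^(-α)`
(`boundaryMeasure_ball_ge_or_nonlocalMeanCurvature_ge`). Choosing `R` in terms of `|E|`, one gets
`|E|^(-sp / n) ≤ C (∫_{∂Ω \ E} |x - y|^(-n - sp) dy + H_α(x)^(sp / α))` for `x ∈ E ⊆ ∂Ω`
(`exists_measure_rpow_le_lintegral_compl_add`).

*Level sets.* Applied to `E = {|u| > 2ᵏ}` and summed over `k`, this yields `∑ 2^(k p) |{|u| >
2ᵏ}|^(1 - sp / n) ≤ C E(u)`, where `E(u)` is the sum of the two energies
(`exists_tsum_superlevel_le`). This is the Sobolev inequality in the Lorentz space `L^{p*, p}`.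
Since `∫_S |x|^(-β) ≤ C |S|^(1 - β / n)` by the area growth, it contains the whole family of
Hardy–Sobolev inequalities (`exists_lintegral_weight_le_totalEnergy`).

*Interpolation.* For `γ ≥ -a s` the theorem follows by Hölder's inequality from the Hardy–Sobolev
inequality with weight `|x|^(γ / a)` (`interpolationInequality_of_neg_mul_le`). For `γ < -a s` one
has `a < 1` and `q ≠ p*`, and `a` may be perturbed: inside a ball about the origin and outside of
it, Hölder's inequality with the Hardy inequality and two different parameters `b` close to `a`
leaves an integrable power of `|x|`. The radius of the ball is chosen so that both contributions
have the right size, which is possible because for `q ≠ p*` the energy and the `L^q` norm scale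
differently (`interpolationInequality_of_lt_neg_mul`).
-/

/-! ### Coordinate projections -/

/-- The projection `ℝⁿ⁺¹ → ℝⁿ` that forgets the `i`-th coordinate. -/
def dropCoord {n : ℕ} (i : Fin (n + 1)) (y : EuclideanSpace ℝ (Fin (n + 1))) :
    EuclideanSpace ℝ (Fin n) :=
  WithLp.toLp 2 fun j => y (i.succAbove j)

section Projection

variable {n : ℕ} (i : Fin (n + 1)) (x y : EuclideanSpace ℝ (Fin (n + 1)))

@[simp]
theorem dropCoord_apply (j : Fin n) : dropCoord i y j = y (i.succAbove j) := rfl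

theorem dropCoord_sub : dropCoord i (x - y) = dropCoord i x - dropCoord i y := rfl

theorem norm_sq_eq_dropCoord : ‖y‖ ^ 2 = y i ^ 2 + ‖dropCoord i y‖ ^ 2 := by
  rw [EuclideanSpace.norm_sq_eq, EuclideanSpace.norm_sq_eq, Fin.sum_univ_succAbove _ i]
  simp

theorem norm_dropCoord_le : ‖dropCoord i y‖ ≤ ‖y‖ := by
  have := norm_sq_eq_dropCoord i y
  exact abs_le_of_sq_le_sq' (by nlinarith [sq_nonneg (y i)]) (norm_nonneg _) |>.2

theorem abs_apply_le_norm : |y i| ≤ ‖y‖ := by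
  simpa using PiLp.norm_apply_le y i

theorem norm_le_abs_add_norm_dropCoord : ‖y‖ ≤ |y i| + ‖dropCoord i y‖ := by
  have := norm_sq_eq_dropCoord i y
  refine abs_le_of_sq_le_sq' ?_ (by positivity) |>.2
  nlinarith [sq_abs (y i), mul_nonneg (abs_nonneg (y i)) (norm_nonneg (dropCoord i y))]

theorem lipschitzWith_dropCoord : LipschitzWith 1 (dropCoord (n := n) i) :=
  LipschitzWith.of_dist_le_mul fun x y => by
    rw [dist_eq_norm, dist_eq_norm, ← dropCoord_sub]
    simpa using norm_dropCoord_le i (x - y)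

end Projection

/-! ### Supporting cones of convex sets -/

section Steep

variable {n : ℕ}

/-- `Ω` lies below a cone of slope `n` with apex `x` and axis in the direction `σ eᵢ`. -/
def LiesBelowCone (Ω : Set (EuclideanSpace ℝ (Fin (n + 1)))) (i : Fin (n + 1)) (σ : ℝ)
    (x : EuclideanSpace ℝ (Fin (n + 1))) : Prop :=
  ∀ y ∈ closure Ω, σ * (y i - x i) ≤ n * ‖dropCoord i (y - x)‖

/-- The coordinate direction is the one in which the normal of a supporting hyperplane has its
largest component. -/
theorem exists_liesBelowCone {Ω : Set (EuclideanSpace ℝ (Fin (n + 1)))} (hΩ : IsOpen Ω)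
    (hc : Convex ℝ Ω) {x : EuclideanSpace ℝ (Fin (n + 1))} (hx : x ∈ frontier Ω) :
    ∃ i, ∃ σ : ℝ, (σ = 1 ∨ σ = -1) ∧ LiesBelowCone Ω i σ x := by
  have hxΩ : x ∉ Ω := by
    rw [hΩ.frontier_eq] at hx
    exact hx.2
  obtain ⟨f, hf⟩ := geometric_hahn_banach_open_point hc hΩ hxΩ
  obtain ⟨z, hz⟩ : Ω.Nonempty := by
    rw [← closure_nonempty_iff]
    exact ⟨x, frontier_subset_closure hx⟩
  have hcl : ∀ y ∈ closure Ω, f y ≤ f x := fun y hy =>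
    closure_minimal (fun a ha => (hf a ha).le) (isClosed_le f.continuous continuous_const) hy
  set c : Fin (n + 1) → ℝ := fun j => f (EuclideanSpace.single j 1) with hcdef
  have hsum : ∀ w, f w = ∑ j, w j * c j := by
    intro w
    have hw : w = ∑ j, w j • EuclideanSpace.single j (1 : ℝ) := by
      ext k
      simp [Finset.sum_apply, Pi.single_apply]
    conv_lhs => rw [hw]
    simp [hcdef]
  obtain ⟨i, -, hi⟩ := Finset.exists_max_image Finset.univ (fun j => |c j|) ⟨0, Finset.mem_univ _⟩
  have hci : c i ≠ 0 := by
    intro h0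
    have h : ∀ j, c j = 0 := fun j => by
      have := hi j (Finset.mem_univ _)
      rw [h0, abs_zero] at this
      exact abs_eq_zero.1 (le_antisymm this (abs_nonneg _))
    have := hf z hz
    simp [hsum, h] at this
  have hpos : 0 < |c i| := abs_pos.2 hci
  obtain ⟨σ, hσ, hσc⟩ : ∃ σ : ℝ, (σ = 1 ∨ σ = -1) ∧ c i = σ * |c i| := by
    rcases le_total 0 (c i) with h | h
    · exact ⟨1, Or.inl rfl, by rw [abs_of_nonneg h, one_mul]⟩
    · exact ⟨-1, Or.inr rfl, by rw [abs_of_nonpos h]; ring⟩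
  refine ⟨i, σ, hσ, fun y hy => ?_⟩
  set w := y - x with hw
  have h1 : f w ≤ 0 := by
    rw [hw, map_sub]
    linarith [hcl y hy]
  rw [hsum, Fin.sum_univ_succAbove _ i] at h1
  have h2 : -(n * (‖dropCoord i w‖ * |c i|)) ≤
      ∑ j : Fin n, w (i.succAbove j) * c (i.succAbove j) := by
    have : ∑ _j : Fin n, -(‖dropCoord i w‖ * |c i|) ≤
        ∑ j : Fin n, w (i.succAbove j) * c (i.succAbove j) := by
      refine Finset.sum_le_sum fun j _ => ?_
      refine le_trans ?_ (neg_abs_le _)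
      rw [abs_mul, neg_le_neg_iff]
      refine mul_le_mul ?_ (hi _ (Finset.mem_univ _)) (abs_nonneg _) (norm_nonneg _)
      simpa using PiLp.norm_apply_le (dropCoord i w) j
    simpa using this
  have h3 : w i = y i - x i := rfl
  rw [← h3]
  have h4 : w i * c i = (σ * w i) * |c i| := by
    rw [hσc, abs_mul]
    rcases hσ with h | h <;> simp [h]
  rw [h4] at h1
  have : (σ * w i) * |c i| ≤ (n * ‖dropCoord i w‖) * |c i| := by nlinarith
  exact le_of_mul_le_mul_right this hpos

/-- Over the boundary points with a common cone direction, `∂Ω` is a Lipschitz graph. -/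
theorem LiesBelowCone.norm_sub_le {Ω : Set (EuclideanSpace ℝ (Fin (n + 1)))} {i : Fin (n + 1)}
    {σ : ℝ} (hσ : σ = 1 ∨ σ = -1) {x y : EuclideanSpace ℝ (Fin (n + 1))}
    (hx : x ∈ closure Ω) (hy : y ∈ closure Ω) (hxc : LiesBelowCone Ω i σ x)
    (hyc : LiesBelowCone Ω i σ y) :
    ‖x - y‖ ≤ (n + 1) * ‖dropCoord i x - dropCoord i y‖ := by
  have h1 := hxc y hy
  have h2 := hyc x hx
  have h3 := norm_le_abs_add_norm_dropCoord i (x - y)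
  rw [dropCoord_sub, norm_sub_rev] at h1
  rw [dropCoord_sub] at h2 h3
  have h4 : |(x - y) i| ≤ n * ‖dropCoord i x - dropCoord i y‖ := by
    have : (x - y) i = x i - y i := rfl
    rw [this]
    rcases hσ with rfl | rfl <;> exact abs_le.2 ⟨by linarith, by linarith⟩
  linarith

end Steep

/-! ### Area of convex hypersurfaces in balls -/

section Area

variable {n : ℕ}

theorem LipschitzOnWith.euclideanHausdorffMeasure_image_le {X Y : Type*} [EMetricSpace X]
    [MeasurableSpace X] [BorelSpace X] [EMetricSpace Y] [MeasurableSpace Y] [BorelSpace Y]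
    {K : NNReal} {f : X → Y} {s : Set X} (h : LipschitzOnWith K f s) (d : ℕ) :
    Measure.euclideanHausdorffMeasure d (f '' s) ≤
      (K : ℝ≥0∞) ^ d * Measure.euclideanHausdorffMeasure d s := by
  simp only [Measure.euclideanHausdorffMeasure_def, Measure.smul_apply]
  have := h.hausdorffMeasure_image_le (d := d) (by positivity)
  rw [ENNReal.rpow_natCast] at this
  simp only [ENNReal.smul_def, smul_eq_mul]
  exact (mul_le_mul' le_rfl this).trans_eq (by ring)

theorem euclideanHausdorffMeasure_image_dropCoord_le (i : Fin (n + 1))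
    (s : Set (EuclideanSpace ℝ (Fin (n + 1)))) :
    volume (dropCoord i '' s) ≤ Measure.euclideanHausdorffMeasure n s := by
  rw [← EuclideanSpace.euclideanHausdorffMeasure_eq_volume]
  simpa using ((lipschitzWith_dropCoord i).lipschitzOnWith
    (s := s)).euclideanHausdorffMeasure_image_le n

/-- The part of `∂Ω` with a common cone direction is parametrized by its shadow. -/
theorem euclideanHausdorffMeasure_liesBelowCone_le {Ω : Set (EuclideanSpace ℝ (Fin (n + 1)))}
    (i : Fin (n + 1)) {σ : ℝ} (hσ : σ = 1 ∨ σ = -1) (R : ℝ) :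
    Measure.euclideanHausdorffMeasure n
      ({x | LiesBelowCone Ω i σ x} ∩ (frontier Ω ∩ Metric.ball 0 R)) ≤
      ((n + 1 : NNReal) : ℝ≥0∞) ^ n * volume (Metric.ball (0 : EuclideanSpace ℝ (Fin n)) R) := by
  set S := {x | LiesBelowCone Ω i σ x} ∩ (frontier Ω ∩ Metric.ball 0 R) with hS
  have hb : ∀ x ∈ S, ∀ y ∈ S, ‖x - y‖ ≤ (n + 1) * ‖dropCoord i x - dropCoord i y‖ :=
    fun x hx y hy => LiesBelowCone.norm_sub_le hσ (frontier_subset_closure hx.2.1)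
      (frontier_subset_closure hy.2.1) hx.1 hy.1
  have hinj : InjOn (dropCoord i) S := fun x hx y hy hxy => by
    have := hb x hx y hy
    rw [hxy, sub_self, norm_zero, mul_zero] at this
    exact sub_eq_zero.1 (norm_le_zero_iff.1 this)
  set g := Function.invFunOn (dropCoord i) S with hg
  have hgS : g '' (dropCoord i '' S) = S := by
    rw [image_image]
    refine (image_congr fun x hx => ?_).trans (image_id S)
    exact hinj.leftInvOn_invFunOn hx
  have hgl : LipschitzOnWith (n + 1 : NNReal) g (dropCoord i '' S) := by
    refine LipschitzOnWith.of_dist_le_mul ?_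
    rintro _ ⟨x, hx, rfl⟩ _ ⟨y, hy, rfl⟩
    rw [hg, hinj.leftInvOn_invFunOn hx, hinj.leftInvOn_invFunOn hy, dist_eq_norm, dist_eq_norm]
    simpa using hb x hx y hy
  have := hgl.euclideanHausdorffMeasure_image_le n
  rw [hgS, EuclideanSpace.euclideanHausdorffMeasure_eq_volume] at this
  refine this.trans ?_
  gcongr
  rintro _ ⟨x, hx, rfl⟩
  have := hx.2.2
  rw [mem_ball_zero_iff] at this ⊢
  exact (norm_dropCoord_le i x).trans_lt this

/-- The area of the boundary of a convex set inside a ball is at most a multiple of the area of the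
sphere. -/
theorem exists_boundaryMeasure_ball_le (n : ℕ) :
    ∃ A : ℝ, 0 < A ∧ ∀ Ω : Set (EuclideanSpace ℝ (Fin (n + 1))), IsOpen Ω → Convex ℝ Ω →
      ∀ R : ℝ, 0 < R → boundaryMeasure Ω (Metric.ball 0 R) ≤ ENNReal.ofReal (A * R ^ n) := by
  set v : ℝ := (volume (Metric.ball (0 : EuclideanSpace ℝ (Fin n)) 1)).toReal with hv
  have hv0 : 0 < v := ENNReal.toReal_pos (Metric.measure_ball_pos _ _ one_pos).ne'
    measure_ball_lt_top.ne
  refine ⟨2 * (n + 1) * ((n + 1) ^ n * v), by positivity, fun Ω hΩ hc R hR => ?_⟩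
  rw [boundaryMeasure, Measure.restrict_apply Metric.isOpen_ball.measurableSet, inter_comm]
  set B : ℝ≥0∞ := ((n + 1 : NNReal) : ℝ≥0∞) ^ n *
    volume (Metric.ball (0 : EuclideanSpace ℝ (Fin n)) R) with hB
  have hBv : B = ENNReal.ofReal ((n + 1) ^ n * v * R ^ n) := by
    have hvv : volume (Metric.ball (0 : EuclideanSpace ℝ (Fin n)) 1) = ENNReal.ofReal v :=
      (ENNReal.ofReal_toReal measure_ball_lt_top.ne).symm
    rw [hB, Measure.addHaar_ball_of_pos _ _ hR, hvv, ENNReal.ofReal_mul (by positivity),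
      ENNReal.ofReal_mul (by positivity), ENNReal.ofReal_pow (p := (n : ℝ) + 1) (by positivity)]
    have : ENNReal.ofReal ((n : ℝ) + 1) = ((n + 1 : NNReal) : ℝ≥0∞) := by
      rw [← ENNReal.ofReal_coe_nnreal]; norm_num
    rw [this]
    simp only [finrank_euclideanSpace, Fintype.card_fin]
    ring
  have hsub : frontier Ω ∩ Metric.ball 0 R ⊆ ⋃ i : Fin (n + 1),
      (({x | LiesBelowCone Ω i 1 x} ∩ (frontier Ω ∩ Metric.ball 0 R)) ∪
        ({x | LiesBelowCone Ω i (-1) x} ∩ (frontier Ω ∩ Metric.ball 0 R))) := by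
    intro x hx
    obtain ⟨i, σ, rfl | rfl, h⟩ := exists_liesBelowCone hΩ hc hx.1
    · exact mem_iUnion.2 ⟨i, Or.inl ⟨h, hx⟩⟩
    · exact mem_iUnion.2 ⟨i, Or.inr ⟨h, hx⟩⟩
  calc _ ≤ _ := measure_mono hsub
    _ ≤ _ := measure_iUnion_fintype_le _ _
    _ ≤ ∑ _i : Fin (n + 1), (B + B) := by
        refine Finset.sum_le_sum fun i _ => (measure_union_le _ _).trans ?_
        exact add_le_add (euclideanHausdorffMeasure_liesBelowCone_le i (Or.inl rfl) R)
          (euclideanHausdorffMeasure_liesBelowCone_le i (Or.inr rfl) R)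
    _ = ENNReal.ofReal (2 * (n + 1) * ((n + 1) ^ n * v) * R ^ n) := by
        rw [hBv, Finset.sum_const, Finset.card_univ, Fintype.card_fin, nsmul_eq_mul,
          ← ENNReal.ofReal_add (by positivity) (by positivity), ← ENNReal.ofReal_natCast,
          ← ENNReal.ofReal_mul (by positivity)]
        congr 1
        push_cast
        ring

end Area

/-! ### Volume near a boundary point -/

section Cylinder

variable {n : ℕ}

theorem volume_le_of_subset_cylinder (i : Fin (n + 1)) {s : Set (EuclideanSpace ℝ (Fin (n + 1)))}
    {b R : ℝ} (hb : ∀ y ∈ s, y i ∈ Icc (b - R) (b + R)) :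
    volume s ≤ ENNReal.ofReal (2 * R) * volume (dropCoord i '' s) := by
  have h1 := EuclideanSpace.volume_preserving_symm_measurableEquiv_toLp (Fin (n + 1))
  have h2 := volume_preserving_piFinSuccAbove (fun _ : Fin (n + 1) => ℝ) i
  have h3 := (EuclideanSpace.volume_preserving_symm_measurableEquiv_toLp (Fin n)).symm
  have h4 : MeasurePreserving (fun y : EuclideanSpace ℝ (Fin (n + 1)) => (y i, dropCoord i y))
      volume (volume.prod volume) :=
    ((MeasurePreserving.id volume).prod h3).comp (h2.comp h1)
  set t := toMeasurable volume (dropCoord i '' s)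
  have ht : MeasurableSet (Icc (b - R) (b + R) ×ˢ t) :=
    measurableSet_Icc.prod (measurableSet_toMeasurable _ _)
  have hsub : s ⊆ (fun y : EuclideanSpace ℝ (Fin (n + 1)) => (y i, dropCoord i y)) ⁻¹'
      (Icc (b - R) (b + R) ×ˢ t) :=
    fun y hy => ⟨hb y hy, subset_toMeasurable _ _ ⟨y, hy, rfl⟩⟩
  refine (measure_mono hsub).trans_eq ?_
  rw [h4.measure_preimage ht.nullMeasurableSet, Measure.prod_prod, measure_toMeasurable,
    Real.volume_Icc]
  congr 2
  ring

/-- Following the cone axis from a point of `Ω` leads out of `Ω`, so near a boundary point the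
shadow of `Ω` is contained in the shadow of `∂Ω`. -/
theorem volume_inter_ball_le {Ω : Set (EuclideanSpace ℝ (Fin (n + 1)))} (hΩ : IsOpen Ω)
    (hc : Convex ℝ Ω) {x : EuclideanSpace ℝ (Fin (n + 1))} (hx : x ∈ frontier Ω) {R : ℝ} :
    volume (Ω ∩ Metric.ball x R) ≤
      ENNReal.ofReal (2 * R) * boundaryMeasure Ω (Metric.ball x ((n + 2) * R)) := by
  obtain ⟨i, σ, hσ, hcone⟩ := exists_liesBelowCone hΩ hc hx
  have hσ1 : |σ| = 1 := by rcases hσ with rfl | rfl <;> simp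
  have hσ2 : σ * σ = 1 := by rcases hσ with rfl | rfl <;> simp
  have hcyl : ∀ y ∈ Ω ∩ Metric.ball x R, y i ∈ Icc (x i - R) (x i + R) := by
    intro y hy
    have h1 := (abs_apply_le_norm i (y - x)).trans_lt (mem_ball_iff_norm.1 hy.2)
    have h2 : (y - x) i = y i - x i := rfl
    rw [h2, abs_lt] at h1
    exact ⟨by linarith, by linarith⟩
  refine (volume_le_of_subset_cylinder i hcyl).trans ?_
  gcongr
  rw [boundaryMeasure, Measure.restrict_apply Metric.isOpen_ball.measurableSet]
  refine le_trans (measure_mono ?_) (euclideanHausdorffMeasure_image_dropCoord_le i _)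
  rintro _ ⟨z, hz, rfl⟩
  have hzR : ‖z - x‖ < R := mem_ball_iff_norm.1 hz.2
  have hR : 0 < R := (norm_nonneg _).trans_lt hzR
  set T : ℝ := (n + 1) * R with hT
  set path : ℝ → EuclideanSpace ℝ (Fin (n + 1)) :=
    fun t => z + (t * σ) • EuclideanSpace.single i (1 : ℝ) with hpath
  have hcont : Continuous path := by fun_prop
  have hdrop : ∀ t, dropCoord i (path t) = dropCoord i z := fun t => by
    ext j
    simp [hpath]
  have hend : path T ∉ closure Ω := by
    intro hmem
    have h1 := hcone _ hmem
    rw [dropCoord_sub, hdrop, ← dropCoord_sub] at h1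
    have h2 : path T i = z i + T * σ := by simp [hpath]
    have h3 := (norm_dropCoord_le i (z - x)).trans_lt hzR
    have h4 := (abs_apply_le_norm i (z - x)).trans_lt hzR
    have h5 : (z - x) i = z i - x i := rfl
    have h6 : |σ * (z i - x i)| < R := by rwa [abs_mul, hσ1, one_mul, ← h5]
    have h7 : (n : ℝ) * ‖dropCoord i (z - x)‖ ≤ n * R := by gcongr
    have h8 : σ * (path T i - x i) = σ * (z i - x i) + T * (σ * σ) := by rw [h2]; ring
    rw [h8, hσ2, hT] at h1
    linarith [(abs_lt.1 h6).1]
  have hpre : IsPreconnected (path '' Icc 0 T) := isPreconnected_Icc.image _ hcont.continuousOn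
  have hT0 : 0 ≤ T := by positivity
  obtain ⟨_, ⟨t, ht, rfl⟩, hfr⟩ : (path '' Icc 0 T ∩ frontier Ω).Nonempty := by
    by_contra hne
    rw [not_nonempty_iff_eq_empty, hΩ.frontier_eq] at hne
    have := hpre.subset_of_closure_inter_subset hΩ
      ⟨z, ⟨0, ⟨le_rfl, hT0⟩, by simp [hpath]⟩, hz.1⟩ fun y hy => by
        by_contra hyΩ
        exact (hne ▸ ⟨hy.2, hy.1, hyΩ⟩ : y ∈ (∅ : Set _))
    exact hend (subset_closure (this ⟨T, ⟨hT0, le_rfl⟩, rfl⟩))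
  refine ⟨path t, ⟨?_, hfr⟩, hdrop t⟩
  rw [mem_ball_iff_norm]
  have h1 : path t - x = (z - x) + (t * σ) • EuclideanSpace.single i (1 : ℝ) := by
    simp only [hpath]
    abel
  have h2 : ‖(t * σ) • EuclideanSpace.single i (1 : ℝ)‖ = t := by
    rw [norm_smul, Real.norm_eq_abs, abs_mul, hσ1, abs_of_nonneg ht.1]
    simp
  calc ‖path t - x‖ ≤ ‖z - x‖ + t := by
        rw [h1]
        exact (norm_add_le _ _).trans_eq (by rw [h2])
    _ < (n + 2) * R := by linarith [ht.2]

end Cylinder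

/-! ### Lower bounds for the nonlocal mean curvature -/

section Curvature

variable {n : ℕ}

/-- A convex set that fills only a small fraction of a ball centered at a boundary point has large
curvature there: by symmetry, the principal value is at least the integral over an annulus. -/
theorem exists_nonlocalMeanCurvature_ge (n : ℕ) {α : ℝ} (hα : 0 < α) :
    ∃ κ : ℝ, 0 < κ ∧ ∃ c : ℝ, 0 < c ∧ ∀ Ω : Set (EuclideanSpace ℝ (Fin (n + 1))), IsOpen Ω →
      Convex ℝ Ω → ∀ x ∈ frontier Ω, ∀ R : ℝ, 0 < R →
        volume (Ω ∩ Metric.ball x R) ≤ ENNReal.ofReal (κ * R ^ (n + 1)) →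
          ENNReal.ofReal (c * R ^ (-α)) ≤ (nonlocalMeanCurvature Ω α x).toENNReal := by
  set v : ℝ := (volume (Metric.ball (0 : EuclideanSpace ℝ (Fin (n + 1))) 1)).toReal with hv
  have hv0 : 0 < v := ENNReal.toReal_pos (Metric.measure_ball_pos _ _ one_pos).ne'
    measure_ball_lt_top.ne
  have hball : ∀ (x : EuclideanSpace ℝ (Fin (n + 1))) (r : ℝ), 0 < r →
      volume.real (Metric.ball x r) = v * r ^ (n + 1) := fun x r hr => by
    rw [measureReal_def, Measure.addHaar_ball_of_pos _ _ hr, ENNReal.toReal_mul,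
      ENNReal.toReal_ofReal (by positivity)]
    simp [hv, mul_comm]
  set d : ℝ := (n : ℝ) + 1 + α with hd
  have hd0 : 0 < d := by positivity
  set m : ℝ := (v * (1 - (3 / 4 : ℝ) ^ (n + 1))) with hm
  have hm0 : 0 < m := mul_pos hv0 (sub_pos.2 (pow_lt_one₀ (by norm_num) (by norm_num) (by simp)))
  refine ⟨m / (4 * 2 ^ d), by positivity, α / 2 * (m / 2), by positivity,
    fun Ω hΩ hc x hx R hR hsmall => ?_⟩
  obtain ⟨-, hlim⟩ := nonlocalMeanCurvature_spec hΩ hc hα hx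
  set K : EuclideanSpace ℝ (Fin (n + 1)) → ℝ := fun y =>
    (Ωᶜ.indicator (fun _ => (1 : ℝ)) y - Ω.indicator (fun _ => (1 : ℝ)) y) /
      ‖y - x‖ ^ d with hK
  set S := Metric.ball x R \ Metric.ball x (3 / 4 * R) with hS
  have hSm : MeasurableSet S := measurableSet_ball.diff measurableSet_ball
  have hSsub : S ⊆ {y | R / 2 < ‖y - x‖} := fun y hy => by
    have := hy.2
    rw [mem_ball_iff_norm, not_lt] at this
    show R / 2 < _
    linarith
  have hSvol : volume.real S = m * R ^ (n + 1) := by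
    rw [hS, measureReal_sdiff (Metric.ball_subset_ball (by linarith)) measurableSet_ball
      measure_ball_lt_top.ne, hball x R hR, hball x _ (by positivity), hm, mul_pow]
    ring
  have hint : ∀ {ε}, 0 < ε → IntegrableOn K {y | ε < ‖y - x‖} :=
    fun hε => integrableOn_truncatedKernel hΩ hα hε x
  have hSint : IntegrableOn K S := (hint (half_pos hR)).mono_set hSsub
  have hΩS : volume.real (Ω ∩ S) ≤ m / (4 * 2 ^ d) * R ^ (n + 1) := by
    refine ENNReal.toReal_le_of_le_ofReal (by positivity) (le_trans (measure_mono ?_) hsmall)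
    exact inter_subset_inter_right _ sdiff_subset
  have hfinS : volume S ≠ ⊤ := (measure_mono sdiff_subset).trans_lt measure_ball_lt_top |>.ne
  have hSK : m / 2 * R ^ (-α) ≤ ∫ y in S, K y := by
    set g : EuclideanSpace ℝ (Fin (n + 1)) → ℝ := fun y =>
      1 / R ^ d - Ω.indicator (fun _ => 2 / (R / 2) ^ d) y with hg
    have hgint : IntegrableOn g S := by
      refine (integrableOn_const hfinS).sub ?_
      exact ((integrableOn_const hfinS).indicator hΩ.measurableSet)
    have hgK : ∀ y ∈ S, g y ≤ K y := by
      intro y hy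
      have h1 : ‖y - x‖ < R := mem_ball_iff_norm.1 hy.1
      have h2 : R / 2 < ‖y - x‖ := hSsub hy
      have h0 : 0 < ‖y - x‖ := by linarith
      have h3 : 1 / R ^ d ≤ 1 / ‖y - x‖ ^ d := by gcongr
      have h4 : 1 / ‖y - x‖ ^ d ≤ 1 / (R / 2) ^ d := by gcongr
      by_cases hyΩ : y ∈ Ω
      · simp only [hg, hK, indicator_of_mem hyΩ, indicator_of_notMem (notMem_compl_iff.2 hyΩ)]
        have : (2 : ℝ) / (R / 2) ^ d = 2 * (1 / (R / 2) ^ d) := by ring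
        rw [this, zero_sub, neg_div]
        linarith
      · simp only [hg, hK, indicator_of_notMem hyΩ, indicator_of_mem (mem_compl hyΩ)]
        simpa using h3
    refine le_trans ?_ (setIntegral_mono_on hgint hSint hSm hgK)
    have hgi : ∫ y in S, g y =
        1 / R ^ d * volume.real S - 2 / (R / 2) ^ d * volume.real (Ω ∩ S) := by
      have hi1 : IntegrableOn (fun _ => 1 / R ^ d)  S := integrableOn_const hfinS
      have hi2 : IntegrableOn (Ω.indicator fun _ => 2 / (R / 2) ^ d) S :=
        IntegrableOn.indicator (integrableOn_const hfinS) hΩ.measurableSet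
      rw [hg, integral_sub hi1 hi2, integral_indicator hΩ.measurableSet,
        Measure.restrict_restrict hΩ.measurableSet]
      simp [mul_comm]
    rw [hgi, hSvol]
    have h1 : R ^ d = R ^ (n + 1) * R ^ α := by
      rw [hd, Real.rpow_add hR]
      congr 1
      exact_mod_cast Real.rpow_natCast R (n + 1)
    have h2 : (R / 2) ^ d = R ^ d / 2 ^ d := Real.div_rpow hR.le (by norm_num) _
    have h3 : 2 / (R / 2) ^ d * volume.real (Ω ∩ S) ≤
        2 / (R / 2) ^ d * (m / (4 * 2 ^ d) * R ^ (n + 1)) := by gcongr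
    refine le_trans (le_of_eq ?_) (sub_le_sub_left h3 _)
    rw [h2, h1, Real.rpow_neg hR.le]
    have : (0 : ℝ) < 2 ^ d := by positivity
    field_simp
    ring
  have hev : ∀ᶠ ε in 𝓝[>] (0 : ℝ), ((α / 2 * (m / 2) * R ^ (-α) : ℝ) : EReal) ≤
      (truncatedMeanCurvature Ω α ε x : EReal) := by
    filter_upwards [Ioo_mem_nhdsGT (half_pos hR)] with ε hε
    rw [EReal.coe_le_coe_iff, truncatedMeanCurvature, mul_assoc]
    refine mul_le_mul_of_nonneg_left ?_ (by positivity)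
    have hmeas : MeasurableSet {y : EuclideanSpace ℝ (Fin (n + 1)) | ε < ‖y - x‖} :=
      measurableSet_lt measurable_const (by fun_prop)
    have hsub : S ⊆ {y | ε < ‖y - x‖} := fun y hy => hε.2.trans (hSsub hy)
    have h0 := setIntegral_kernel_nonneg hΩ hc hα hε.1 hx (hmeas.diff hSm) sdiff_subset
      fun y => by
        have hn : ‖x + x - y - x‖ = ‖y - x‖ := by
          rw [← norm_neg]
          congr 1
          abel
        simp only [hS, Set.mem_sdiff, mem_ofPred_eq, mem_ball_iff_norm, hn]
    rw [setIntegral_sdiff hSm (hint hε.1) hsub] at h0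
    linarith
  have := ge_of_tendsto hlim hev
  have h2 := EReal.toENNReal_le_toENNReal this
  rwa [EReal.real_coe_toENNReal] at h2

/-- At every boundary point and every scale, either the boundary has substantial area or the
curvature is large. -/
theorem boundaryMeasure_ball_ge_or_nonlocalMeanCurvature_ge (n : ℕ) {α : ℝ} (hα : 0 < α) :
    ∃ δ : ℝ, 0 < δ ∧ ∃ c : ℝ, 0 < c ∧ ∀ Ω : Set (EuclideanSpace ℝ (Fin (n + 1))), IsOpen Ω →
      Convex ℝ Ω → ∀ x ∈ frontier Ω, ∀ R : ℝ, 0 < R →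
        ENNReal.ofReal (δ * R ^ n) ≤ boundaryMeasure Ω (Metric.ball x R) ∨
          ENNReal.ofReal (c * R ^ (-α)) ≤ (nonlocalMeanCurvature Ω α x).toENNReal := by
  obtain ⟨κ, hκ, c, hc0, h⟩ := exists_nonlocalMeanCurvature_ge n hα
  refine ⟨κ / 2 / (n + 2) ^ n, by positivity, c * (n + 2) ^ α, by positivity,
    fun Ω hΩ hc x hx R hR => ?_⟩
  rcases le_total (ENNReal.ofReal (κ / 2 / (n + 2) ^ n * R ^ n))
    (boundaryMeasure Ω (Metric.ball x R)) with hle | hle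
  · exact Or.inl hle
  right
  set r : ℝ := R / (n + 2) with hr
  have hr0 : 0 < r := by positivity
  have hrR : (n + 2) * r = R := by rw [hr]; field_simp
  have h1 := volume_inter_ball_le hΩ hc hx (R := r)
  rw [hrR] at h1
  have h2 : volume (Ω ∩ Metric.ball x r) ≤ ENNReal.ofReal (κ * r ^ (n + 1)) := by
    refine h1.trans ((mul_le_mul' le_rfl hle).trans_eq ?_)
    rw [← ENNReal.ofReal_mul (by positivity), ← hrR]
    congr 1
    rw [mul_pow, pow_succ]
    field_simp
  refine le_trans (le_of_eq ?_) (h Ω hΩ hc x hx r hr0 h2)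
  rw [hr, Real.div_rpow hR.le (by positivity), Real.rpow_neg (by positivity) (x := (n : ℝ) + 2)]
  congr 1
  field_simp

end Curvature

/-- A set `E ⊆ ∂Ω` of finite area is seen from each of its points as in `ℝⁿ`: the fractional
perimeter density of `E` is at least `|E|^(-β / n)`, up to the contribution of the curvature. -/
theorem exists_measure_rpow_le_lintegral_compl_add (n : ℕ) (hn : 1 ≤ n) {α β : ℝ} (hα : 0 < α)
    (hβ : 0 < β) :
    ∃ c : ℝ, 0 < c ∧ ∀ Ω : Set (EuclideanSpace ℝ (Fin (n + 1))), IsOpen Ω → Convex ℝ Ω →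
      ∀ E : Set (EuclideanSpace ℝ (Fin (n + 1))), MeasurableSet E → boundaryMeasure Ω E ≠ 0 →
        boundaryMeasure Ω E ≠ ⊤ → ∀ x ∈ frontier Ω, x ∈ E →
          ENNReal.ofReal c * boundaryMeasure Ω E ^ (-(β / n)) ≤
            (∫⁻ y in Eᶜ, ENNReal.ofReal (1 / ‖x - y‖ ^ (n + β)) ∂boundaryMeasure Ω) +
              (nonlocalMeanCurvature Ω α x).toENNReal ^ (β / α) := by
  obtain ⟨δ, hδ, c, hc0, h⟩ := boundaryMeasure_ball_ge_or_nonlocalMeanCurvature_ge n hα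
  have hn0 : (0 : ℝ) < n := by exact_mod_cast hn
  set c₁ : ℝ := (2 / δ) ^ (-((n + β) / n)) with hc₁
  set c₂ : ℝ := c ^ (β / α) * (2 / δ) ^ (-(β / n)) with hc₂
  have hc₁0 : 0 < c₁ := by positivity
  have hc₂0 : 0 < c₂ := by positivity
  refine ⟨min c₁ c₂, lt_min hc₁0 hc₂0, fun Ω hΩ hc E hE hE0 hEtop x hx hxE => ?_⟩
  set μ := boundaryMeasure Ω with hμ
  set m : ℝ := (μ E).toReal with hm
  have hm0 : 0 < m := ENNReal.toReal_pos hE0 hEtop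
  have hmE : μ E = ENNReal.ofReal m := (ENNReal.ofReal_toReal hEtop).symm
  -- the radius for which the alternative concerns the area `2 |E|`
  set R : ℝ := (2 / δ * m) ^ (1 / (n : ℝ)) with hR
  have hR0 : 0 < R := by positivity
  have hRpow : ∀ z : ℝ, R ^ z = (2 / δ) ^ (z / n) * m ^ (z / n) := fun z => by
    rw [hR, ← Real.rpow_mul (by positivity), Real.mul_rpow (by positivity) hm0.le]
    congr 2 <;> ring
  have hRn : R ^ n = 2 / δ * m := by
    rw [← Real.rpow_natCast, hRpow, div_self hn0.ne', Real.rpow_one, Real.rpow_one]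
  rw [hmE, ENNReal.ofReal_rpow_of_pos hm0, ← ENNReal.ofReal_mul (lt_min hc₁0 hc₂0).le]
  rcases h Ω hΩ hc x hx R hR0 with hball | hcurv
  · refine le_trans ?_ le_self_add
    have hmass : ENNReal.ofReal m ≤ μ (Metric.ball x R \ E) := by
      have h1 : ENNReal.ofReal (δ * R ^ n) - μ E ≤ μ (Metric.ball x R \ E) :=
        (tsub_le_tsub_right hball _).trans le_measure_sdiff
      refine le_trans (le_of_eq ?_) h1
      rw [hmE, ← ENNReal.ofReal_sub _ hm0.le, hRn]
      congr 1
      field_simp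
      ring
    have hker : ∀ y ∈ Metric.ball x R \ E,
        ENNReal.ofReal (R ^ (-(n + β))) ≤ ENNReal.ofReal (1 / ‖x - y‖ ^ (n + β)) := by
      intro y hy
      have hne : 0 < ‖x - y‖ := norm_pos_iff.2 (sub_ne_zero.2 fun h => hy.2 (h ▸ hxE))
      have hlt : ‖x - y‖ < R := by rw [norm_sub_rev]; exact mem_ball_iff_norm.1 hy.1
      refine ENNReal.ofReal_le_ofReal ?_
      rw [Real.rpow_neg hR0.le, ← one_div]
      gcongr
    calc ENNReal.ofReal (min c₁ c₂ * m ^ (-(β / n)))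
        ≤ ENNReal.ofReal (R ^ (-(n + β)) * m) := by
          refine ENNReal.ofReal_le_ofReal ?_
          have h1 : R ^ (-(n + β)) * m = c₁ * m ^ (-(β / n)) := by
            rw [hRpow, hc₁, mul_assoc, neg_div, ← Real.rpow_add_one hm0.ne']
            congr 2
            field_simp
            ring
          rw [h1]
          gcongr
          exact min_le_left _ _
      _ = ENNReal.ofReal (R ^ (-(n + β))) * ENNReal.ofReal m :=
          ENNReal.ofReal_mul (by positivity)
      _ ≤ ENNReal.ofReal (R ^ (-(n + β))) * μ (Metric.ball x R \ E) := by gcongr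
      _ = ∫⁻ _ in Metric.ball x R \ E, ENNReal.ofReal (R ^ (-(n + β))) ∂μ := by
          rw [setLIntegral_const]
      _ ≤ ∫⁻ y in Metric.ball x R \ E, ENNReal.ofReal (1 / ‖x - y‖ ^ (n + β)) ∂μ :=
          setLIntegral_mono' (measurableSet_ball.diff hE) hker
      _ ≤ _ := lintegral_mono_set fun y hy => hy.2
  · refine le_trans ?_ le_add_self
    calc ENNReal.ofReal (min c₁ c₂ * m ^ (-(β / n)))
        ≤ ENNReal.ofReal ((c * R ^ (-α)) ^ (β / α)) := by
          refine ENNReal.ofReal_le_ofReal ?_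
          have h1 : (c * R ^ (-α)) ^ (β / α) = c₂ * m ^ (-(β / n)) := by
            rw [Real.mul_rpow hc0.le (by positivity), ← Real.rpow_mul hR0.le, hRpow, hc₂, mul_assoc]
            have : -α * (β / α) / n = -(β / n) := by field_simp
            rw [this]
          rw [h1]
          gcongr
          exact min_le_right _ _
      _ = ENNReal.ofReal (c * R ^ (-α)) ^ (β / α) :=
          (ENNReal.ofReal_rpow_of_pos (by positivity)).symm
      _ ≤ _ := ENNReal.rpow_le_rpow hcurv (by positivity)

/-! ### Sequences of measures of superlevel sets -/

section Sequences

/-- For `0 < θ < 1`, either `x ≤ t y`, or `x` and `y` are comparable. -/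
theorem rpow_le_mul_rpow_add_mul_mul_rpow {x y t : ℝ≥0∞} {θ : ℝ} (hθ0 : 0 < θ) (hθ1 : θ < 1)
    (hx : x ≠ ⊤) (ht0 : t ≠ 0) (ht : t ≠ ⊤) :
    x ^ θ ≤ t ^ θ * y ^ θ + t ^ (θ - 1) * (x * y ^ (θ - 1)) := by
  rcases le_total x (t * y) with h | h
  · refine le_trans ?_ le_self_add
    rw [← ENNReal.mul_rpow_of_nonneg _ _ hθ0.le]
    exact ENNReal.rpow_le_rpow h hθ0.le
  · refine le_trans ?_ le_add_self
    rcases eq_or_ne x 0 with rfl | hx0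
    · simp [hθ0]
    have h1 : x ^ (θ - 1) ≤ (t * y) ^ (θ - 1) := by
      rw [← neg_sub, ENNReal.rpow_neg, ENNReal.rpow_neg]
      exact ENNReal.inv_le_inv.2 (ENNReal.rpow_le_rpow h (by linarith))
    calc x ^ θ = x ^ (1 : ℝ) * x ^ (θ - 1) := by
          rw [← ENNReal.rpow_add _ _ hx0 hx]; congr 1; ring
      _ ≤ x ^ (1 : ℝ) * (t * y) ^ (θ - 1) := by gcongr
      _ = t ^ (θ - 1) * (x * y ^ (θ - 1)) := by
          have hy : y ≠ ⊤ := by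
            rintro rfl
            rw [ENNReal.mul_top ht0] at h
            exact hx (top_le_iff.1 h)
          rw [ENNReal.rpow_one, ENNReal.mul_rpow_of_ne_top ht hy]
          ring

/-- The absorption argument on finite sums, where the left-hand side is known to be finite. -/
theorem sum_pow_mul_rpow_le {b : ℝ≥0∞} (hb1 : 1 < b) (hb : b ≠ ⊤) {θ : ℝ} (hθ0 : 0 < θ)
    (hθ1 : θ < 1) :
    ∃ C : ℝ≥0∞, C ≠ ⊤ ∧ ∀ a : ℕ → ℝ≥0∞, (∀ k, a k ≠ ⊤) → ∀ N : ℕ,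
      ∑ k ∈ Finset.range N, b ^ k * a k ^ θ ≤
        2 * a 0 ^ θ + C * ∑ k ∈ Finset.range N, b ^ k * (a (k + 1) * a k ^ (θ - 1)) := by
  have hb0 : b ≠ 0 := (zero_lt_one.trans hb1).ne'
  -- chosen so that `b t ^ θ = 1 / 2`
  set t : ℝ≥0∞ := (2 * b)⁻¹ ^ (1 / θ) with ht
  have h2b0 : (2 * b)⁻¹ ≠ 0 := ENNReal.inv_ne_zero.2 (ENNReal.mul_ne_top (by simp) hb)
  have h2b : (2 * b)⁻¹ ≠ ⊤ := ENNReal.inv_ne_top.2 (mul_ne_zero (by simp) hb0)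
  have ht0 : t ≠ 0 := by simp [ht, ENNReal.rpow_eq_zero_iff, h2b0, h2b]
  have htt : t ≠ ⊤ := ENNReal.rpow_ne_top_of_nonneg (by positivity) h2b
  have htθ : b * t ^ θ = 2⁻¹ := by
    rw [ht, ← ENNReal.rpow_mul, one_div_mul_cancel hθ0.ne', ENNReal.rpow_one,
      ENNReal.mul_inv (by simp) (by simp), mul_left_comm, ENNReal.mul_inv_cancel hb0 hb, mul_one]
  refine ⟨2 * (b * t ^ (θ - 1)), ENNReal.mul_ne_top (by simp) (ENNReal.mul_ne_top hb
    (ENNReal.rpow_ne_top_of_ne_zero ht0 htt)), fun a ha N => ?_⟩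
  set X := ∑ k ∈ Finset.range N, b ^ k * a k ^ θ with hX
  set S := ∑ k ∈ Finset.range N, b ^ k * (a (k + 1) * a k ^ (θ - 1)) with hS
  have hXtop : X ≠ ⊤ := ENNReal.sum_ne_top.2 fun k _ =>
    ENNReal.mul_ne_top (ENNReal.pow_ne_top hb) (ENNReal.rpow_ne_top_of_nonneg hθ0.le (ha k))
  have h1 : X ≤ a 0 ^ θ + b * ∑ k ∈ Finset.range N, b ^ k * a (k + 1) ^ θ := by
    calc X ≤ ∑ k ∈ Finset.range (N + 1), b ^ k * a k ^ θ :=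
          Finset.sum_le_sum_of_subset (Finset.range_mono (Nat.le_succ N))
      _ = _ := by
          rw [Finset.sum_range_succ', add_comm, pow_zero, one_mul, Finset.mul_sum]
          congr 1
          exact Finset.sum_congr rfl fun k _ => by rw [pow_succ]; ring
  have h2 : ∑ k ∈ Finset.range N, b ^ k * a (k + 1) ^ θ ≤ t ^ θ * X + t ^ (θ - 1) * S := by
    rw [hX, hS, Finset.mul_sum, Finset.mul_sum, ← Finset.sum_add_distrib]
    refine Finset.sum_le_sum fun k _ => ?_
    calc _ ≤ b ^ k * (t ^ θ * a k ^ θ + t ^ (θ - 1) * (a (k + 1) * a k ^ (θ - 1))) := by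
          gcongr
          exact rpow_le_mul_rpow_add_mul_mul_rpow hθ0 hθ1 (ha _) ht0 htt
      _ = _ := by ring
  have h3 : X ≤ (a 0 ^ θ + b * t ^ (θ - 1) * S) + 2⁻¹ * X := by
    calc X ≤ a 0 ^ θ + b * (t ^ θ * X + t ^ (θ - 1) * S) := h1.trans (by gcongr)
      _ = (a 0 ^ θ + b * t ^ (θ - 1) * S) + (b * t ^ θ) * X := by ring
      _ = _ := by rw [htθ]
  have h4 : 2⁻¹ * X ≤ a 0 ^ θ + b * t ^ (θ - 1) * S := by
    have hX2 : X = 2⁻¹ * X + 2⁻¹ * X := by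
      rw [← add_mul, ENNReal.inv_two_add_inv_two, one_mul]
    have hfin : 2⁻¹ * X ≠ ⊤ := ENNReal.mul_ne_top (by simp) hXtop
    conv_lhs at h3 => rw [hX2]
    exact (ENNReal.add_le_add_iff_right hfin).1 h3
  calc X = 2 * (2⁻¹ * X) := by
        rw [← mul_assoc, ENNReal.mul_inv_cancel (by simp) (by simp), one_mul]
    _ ≤ 2 * (a 0 ^ θ + b * t ^ (θ - 1) * S) := by gcongr
    _ = _ := by ring

/-- The measures `a` of superlevel sets may be replaced by those of single layers `d`, as the
weights `b ^ k` form a geometric progression. -/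
theorem tsum_zpow_mul_mul_rpow_le {b : ℝ≥0∞} (hb1 : 1 < b) (hb : b ≠ ⊤) {ε : ℝ} (hε : 0 < ε)
    {a d : ℤ → ℝ≥0∞} (ha : Antitone a) (had : ∀ k, a (k + 1) = ∑' j : ℕ, d (k + j)) :
    ∑' k : ℤ, b ^ k * (a (k + 1) * a k ^ (-ε)) ≤
      (1 - b⁻¹)⁻¹ * ∑' k : ℤ, b ^ k * (d k * a k ^ (-ε)) := by
  have hb0 : b ≠ 0 := (zero_lt_one.trans hb1).ne'
  set f : ℤ → ℝ≥0∞ := fun k => b ^ k * (d k * a k ^ (-ε)) with hf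
  calc ∑' k : ℤ, b ^ k * (a (k + 1) * a k ^ (-ε))
      ≤ ∑' k : ℤ, ∑' j : ℕ, b⁻¹ ^ j * f (k + j) := by
        refine ENNReal.tsum_le_tsum fun k => ?_
        rw [had, ← ENNReal.tsum_mul_right, ← ENNReal.tsum_mul_left]
        refine ENNReal.tsum_le_tsum fun j => ?_
        have h1 : b ^ k = b⁻¹ ^ j * b ^ (k + j) := by
          rw [ENNReal.zpow_add hb0 hb, zpow_natCast, mul_left_comm, ← mul_pow,
            ENNReal.inv_mul_cancel hb0 hb, one_pow, mul_one]
        have h2 : a k ^ (-ε) ≤ a (k + j) ^ (-ε) := by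
          rw [ENNReal.rpow_neg, ENNReal.rpow_neg]
          exact ENNReal.inv_le_inv.2 (ENNReal.rpow_le_rpow (ha (by simp)) hε.le)
        change _ ≤ b⁻¹ ^ j * (b ^ (k + j) * (d (k + j) * a (k + j) ^ (-ε)))
        rw [h1, mul_assoc]
        gcongr
    _ = ∑' j : ℕ, ∑' k : ℤ, b⁻¹ ^ j * f (k + j) := ENNReal.tsum_comm
    _ = ∑' j : ℕ, b⁻¹ ^ j * ∑' k : ℤ, f k := by
        refine tsum_congr fun j => ?_
        rw [ENNReal.tsum_mul_left]
        congr 1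
        exact (Equiv.addRight (j : ℤ)).tsum_eq f
    _ = _ := by rw [ENNReal.tsum_mul_right, ENNReal.tsum_geometric]

/-- The discrete inequality behind the fractional Sobolev inequality. The a priori bound on
`b ^ k a k` serves only to start the absorption argument; `C` does not depend on it. -/
theorem exists_tsum_zpow_mul_rpow_le {b : ℝ≥0∞} (hb1 : 1 < b) (hb : b ≠ ⊤) {θ : ℝ} (hθ0 : 0 < θ)
    (hθ1 : θ < 1) :
    ∃ C : ℝ≥0∞, C ≠ ⊤ ∧ ∀ a d : ℤ → ℝ≥0∞, Antitone a →
      (∀ k, a (k + 1) = ∑' j : ℕ, d (k + j)) → ∀ M : ℝ≥0∞, M ≠ ⊤ → (∀ k, b ^ k * a k ≤ M) →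
        ∑' k : ℤ, b ^ k * a k ^ θ ≤ C * ∑' k : ℤ, b ^ k * (d k * a k ^ (θ - 1)) := by
  have hb0 : b ≠ 0 := (zero_lt_one.trans hb1).ne'
  obtain ⟨C, hC, hsum⟩ := sum_pow_mul_rpow_le hb1 hb hθ0 hθ1
  have hgeo : (1 - b⁻¹)⁻¹ ≠ ⊤ :=
    ENNReal.inv_ne_top.2 (tsub_pos_of_lt (ENNReal.inv_lt_one.2 hb1)).ne'
  refine ⟨C * (1 - b⁻¹)⁻¹, ENNReal.mul_ne_top hC hgeo, fun a d ha had M hM hbM => ?_⟩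
  have hzpow' : ∀ k : ℤ, b ^ k ≠ ⊤ := fun k => (ENNReal.zpow_lt_top hb0 hb k).ne
  have hcancel : ∀ k : ℤ, b ^ (-k) * b ^ k = 1 := fun k => by
    rw [← ENNReal.zpow_add hb0 hb]; simp
  have haM : ∀ k, a k ≤ b ^ (-k) * M := fun k => by
    calc a k = b ^ (-k) * (b ^ k * a k) := by rw [← mul_assoc, hcancel, one_mul]
      _ ≤ _ := by gcongr; exact hbM k
  have hat : ∀ k, a k ≠ ⊤ := fun k =>
    ((haM k).trans_lt (ENNReal.mul_lt_top (hzpow' _).lt_top hM.lt_top)).ne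
  set S := ∑' k : ℤ, b ^ k * (a (k + 1) * a k ^ (θ - 1)) with hS
  have hSle : S ≤ (1 - b⁻¹)⁻¹ * ∑' k : ℤ, b ^ k * (d k * a k ^ (θ - 1)) := by
    have := tsum_zpow_mul_mul_rpow_le hb1 hb (sub_pos.2 hθ1) ha had
    simpa only [neg_sub] using this
  set r : ℕ → ℝ≥0∞ := fun K => 2 * (M ^ θ * (b ^ (θ - 1)) ^ K) with hr
  have hrlim : Tendsto r atTop (𝓝 0) := by
    have h1 : b ^ (θ - 1) < 1 := ENNReal.rpow_lt_one_of_one_lt_of_neg hb1 (by linarith)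
    have h2 := ENNReal.tendsto_pow_atTop_nhds_zero_of_lt_one h1
    have h3 := ENNReal.Tendsto.const_mul h2
      (Or.inr (ENNReal.rpow_ne_top_of_nonneg hθ0.le hM))
    have h4 := ENNReal.Tendsto.const_mul (a := 2) h3 (Or.inr (by simp))
    simpa using h4
  have hstart : ∀ (K N : ℕ), ∑ k ∈ Finset.range N, b ^ ((k : ℤ) - K) * a ((k : ℤ) - K) ^ θ ≤
      r K + C * S := by
    intro K N
    have h1 := hsum (fun k => a ((k : ℤ) - K)) (fun k => hat _) N
    have hb' : ∀ k : ℕ, b ^ ((k : ℤ) - K) = b ^ (-(K : ℤ)) * b ^ k := fun k => by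
      rw [sub_eq_add_neg, ENNReal.zpow_add hb0 hb, zpow_natCast, mul_comm]
    have h2 : b ^ (-(K : ℤ)) * (2 * a (-(K : ℤ)) ^ θ) ≤ r K := by
      have h3 : a (-(K : ℤ)) ^ θ ≤ (b ^ K * M) ^ θ := by
        refine ENNReal.rpow_le_rpow ?_ hθ0.le
        simpa using haM (-(K : ℤ))
      calc _ ≤ b ^ (-(K : ℤ)) * (2 * (b ^ K * M) ^ θ) := by gcongr
        _ = r K := by
          rw [ENNReal.mul_rpow_of_nonneg _ _ hθ0.le, hr]
          have : b ^ (-(K : ℤ)) * (b ^ K) ^ θ = (b ^ (θ - 1)) ^ K := by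
            rw [← ENNReal.rpow_natCast, ← ENNReal.rpow_natCast, ← ENNReal.rpow_intCast,
              ← ENNReal.rpow_mul, ← ENNReal.rpow_mul, ← ENNReal.rpow_add _ _ hb0 hb]
            congr 1
            push_cast
            ring
          simp only
          rw [← this]
          ring
    have h4 : b ^ (-(K : ℤ)) * ∑ k ∈ Finset.range N,
        b ^ k * (a ((k + 1 : ℕ) - (K : ℤ)) * a ((k : ℤ) - K) ^ (θ - 1)) ≤ S := by
      have hinj : Function.Injective fun k : ℕ => (k : ℤ) - K := fun x y h => by
        simpa using h
      refine le_trans (le_of_eq ?_) ((ENNReal.sum_le_tsum (Finset.range N)).trans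
        (ENNReal.tsum_comp_le_tsum_of_injective hinj
          fun k : ℤ => b ^ k * (a (k + 1) * a k ^ (θ - 1))))
      rw [Finset.mul_sum]
      refine Finset.sum_congr rfl fun k _ => ?_
      rw [hb', mul_assoc]
      congr 5
      push_cast
      ring
    calc _ = b ^ (-(K : ℤ)) * ∑ k ∈ Finset.range N, b ^ k * a ((k : ℤ) - K) ^ θ := by
          rw [Finset.mul_sum]
          exact Finset.sum_congr rfl fun k _ => by rw [hb', mul_assoc]
      _ ≤ b ^ (-(K : ℤ)) * _ := mul_le_mul' le_rfl h1
      _ = b ^ (-(K : ℤ)) * (2 * a (-(K : ℤ)) ^ θ) + C * (b ^ (-(K : ℤ)) * ∑ k ∈ Finset.range N,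
        b ^ k * (a ((k + 1 : ℕ) - (K : ℤ)) * a ((k : ℤ) - K) ^ (θ - 1))) := by
          rw [Nat.cast_zero, zero_sub]
          ring
      _ ≤ _ := by gcongr
  refine le_trans ?_ ((mul_le_mul' (le_refl C) hSle).trans_eq (mul_assoc _ _ _).symm)
  rw [ENNReal.tsum_eq_iSup_sum]
  refine iSup_le fun F => ?_
  have hev : ∀ᶠ K in atTop, ∑ k ∈ F, b ^ k * a k ^ θ ≤ r K + C * S := by
    obtain ⟨K₀, hK₀⟩ : ∃ K₀ : ℕ, ∀ k ∈ F, |k| < K₀ := by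
      refine ⟨∑ k ∈ F, k.natAbs + 1, fun k hk => ?_⟩
      have := Finset.single_le_sum (f := Int.natAbs) (fun _ _ => Nat.zero_le _) hk
      rw [Int.abs_eq_natAbs]
      exact_mod_cast Nat.lt_succ_of_le this
    filter_upwards [eventually_ge_atTop K₀] with K hK
    refine le_trans ?_ (hstart K (2 * K))
    have hinj : ∀ x ∈ Finset.range (2 * K), ∀ y ∈ Finset.range (2 * K),
        (x : ℤ) - K = (y : ℤ) - K → x = y := fun x _ y _ h => by simpa using h
    rw [← Finset.sum_image (f := fun k : ℤ => b ^ k * a k ^ θ) hinj]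
    refine Finset.sum_le_sum_of_subset fun k hk => ?_
    have := abs_lt.1 (hK₀ k hk)
    refine Finset.mem_image.2 ⟨(k + K).toNat, ?_, ?_⟩
    · rw [Finset.mem_range]; omega
    · omega
  have hlim : Tendsto (fun K => r K + C * S) atTop (𝓝 (0 + C * S)) :=
    hrlim.add tendsto_const_nhds
  rw [zero_add] at hlim
  exact ge_of_tendsto hlim hev

end Sequences

/-! ### Dyadic level sets -/

section LevelSets

variable {X : Type*}

/-- The dyadic superlevel set `{|u| > 2ᵏ}`. -/
def superlevel (u : X → ℝ) (k : ℤ) : Set X := {x | (2 : ℝ) ^ k < |u x|}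

/-- The dyadic layer `{2ᵏ < |u| ≤ 2ᵏ⁺¹}`. -/
def dyadicLayer (u : X → ℝ) (k : ℤ) : Set X := {x | (2 : ℝ) ^ k < |u x| ∧ |u x| ≤ 2 ^ (k + 1)}

theorem superlevel_anti (u : X → ℝ) : Antitone (superlevel u) := fun i j h x hx => by
  have hx' : (2 : ℝ) ^ j < |u x| := hx
  exact lt_of_le_of_lt (zpow_le_zpow_right₀ one_le_two h) hx'

theorem dyadicLayer_subset_superlevel (u : X → ℝ) (k : ℤ) : dyadicLayer u k ⊆ superlevel u k :=
  fun _ hx => hx.1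

theorem exists_mem_dyadicLayer {u : X → ℝ} {x : X} (hx : u x ≠ 0) : ∃ k, x ∈ dyadicLayer u k :=
  exists_mem_Ioc_zpow (abs_pos.2 hx) one_lt_two

theorem pairwise_disjoint_dyadicLayer (u : X → ℝ) :
    Pairwise (Function.onFun Disjoint (dyadicLayer u)) := by
  have key : ∀ i j : ℤ, i < j → Disjoint (dyadicLayer u i) (dyadicLayer u j) := fun i j h =>
    disjoint_left.2 fun x hi hj => by
      have h1 := hi.2.trans (zpow_le_zpow_right₀ one_le_two (Int.add_one_le_iff.2 h))
      exact (hj.1.trans_le h1).false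
  intro i j hij
  rcases hij.lt_or_gt with h | h
  · exact key i j h
  · exact (key j i h).symm

theorem superlevel_eq_iUnion_dyadicLayer (u : X → ℝ) (k : ℤ) :
    superlevel u k = ⋃ j : ℕ, dyadicLayer u (k + j) := by
  ext x
  simp only [mem_iUnion]
  constructor
  · intro hx
    have hx0 : u x ≠ 0 := abs_pos.1 ((zpow_pos (zero_lt_two' ℝ) k).trans hx)
    obtain ⟨l, hl⟩ := exists_mem_dyadicLayer hx0
    have hkl : k < l + 1 := (zpow_lt_zpow_iff_right₀ (one_lt_two (α := ℝ))).1
      (lt_of_lt_of_le hx hl.2)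
    refine ⟨(l - k).toNat, ?_⟩
    have : k + ((l - k).toNat : ℤ) = l := by omega
    rwa [this]
  · rintro ⟨j, hj⟩
    exact superlevel_anti u (by simp) (dyadicLayer_subset_superlevel u _ hj)

variable [MeasurableSpace X]

theorem measurableSet_superlevel {u : X → ℝ} (hu : Measurable u) (k : ℤ) :
    MeasurableSet (superlevel u k) :=
  measurableSet_lt measurable_const hu.norm

theorem measurableSet_dyadicLayer {u : X → ℝ} (hu : Measurable u) (k : ℤ) :
    MeasurableSet (dyadicLayer u k) := by
  have h : Measurable fun x => |u x| := hu.norm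
  exact (measurableSet_lt measurable_const h).inter (measurableSet_le h measurable_const)

theorem measure_superlevel_eq_tsum {u : X → ℝ} (hu : Measurable u) (μ : Measure X) (k : ℤ) :
    μ (superlevel u k) = ∑' j : ℕ, μ (dyadicLayer u (k + j)) := by
  rw [superlevel_eq_iUnion_dyadicLayer]
  refine measure_iUnion (fun i j hij => pairwise_disjoint_dyadicLayer u ?_)
    fun j => measurableSet_dyadicLayer hu _
  simpa using hij

theorem tsum_setLIntegral_dyadicLayer_le {u : X → ℝ} (hu : Measurable u) (μ : Measure X)
    (f : X → ℝ≥0∞) : ∑' k : ℤ, ∫⁻ x in dyadicLayer u k, f x ∂μ ≤ ∫⁻ x, f x ∂μ := by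
  rw [← lintegral_iUnion (measurableSet_dyadicLayer hu) (pairwise_disjoint_dyadicLayer u)]
  exact setLIntegral_le_lintegral _ _

theorem lintegral_eq_tsum_dyadicLayer {u : X → ℝ} (hu : Measurable u) (μ : Measure X)
    {f : X → ℝ≥0∞} (hf : ∀ x, u x = 0 → f x = 0) :
    ∫⁻ x, f x ∂μ = ∑' k : ℤ, ∫⁻ x in dyadicLayer u k, f x ∂μ := by
  rw [← lintegral_iUnion (measurableSet_dyadicLayer hu) (pairwise_disjoint_dyadicLayer u),
    ← lintegral_indicator (MeasurableSet.iUnion (measurableSet_dyadicLayer hu))]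
  refine lintegral_congr fun x => ?_
  by_cases hx : u x = 0
  · rw [hf x hx, eq_comm, indicator_apply_eq_zero]
    exact fun _ => hf x hx
  · rw [indicator_of_mem]
    exact mem_iUnion.2 (exists_mem_dyadicLayer hx)

theorem ofReal_two_zpow_rpow {p : ℝ} (k : ℤ) :
    ENNReal.ofReal (((2 : ℝ) ^ k) ^ p) = ((2 : ℝ≥0∞) ^ p) ^ k := by
  rw [← ENNReal.ofReal_rpow_of_pos (by positivity), ← Real.rpow_intCast,
    ← ENNReal.ofReal_rpow_of_pos (by positivity), ← ENNReal.rpow_intCast, ← ENNReal.rpow_mul,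
    ← ENNReal.rpow_mul, mul_comm]
  simp

/-- Chebyshev's inequality on the dyadic scale. -/
theorem zpow_mul_measure_superlevel_le {u : X → ℝ} (hu : Measurable u) (μ : Measure X) {p : ℝ}
    (hp : 0 < p) (k : ℤ) :
    ((2 : ℝ≥0∞) ^ p) ^ k * μ (superlevel u k) ≤ ∫⁻ x, ENNReal.ofReal (|u x| ^ p) ∂μ := by
  refine le_trans ?_ (mul_meas_ge_le_lintegral (by fun_prop) (((2 : ℝ≥0∞) ^ p) ^ k))
  gcongr
  intro x hx
  have hx' : (2 : ℝ) ^ k < |u x| := hx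
  change _ ≤ ENNReal.ofReal (|u x| ^ p)
  rw [← ofReal_two_zpow_rpow]
  gcongr

end LevelSets

/-! ### The Sobolev inequality on superlevel sets -/

section Energy

variable {n : ℕ}

theorem sigmaFinite_boundaryMeasure {Ω : Set (EuclideanSpace ℝ (Fin (n + 1)))}
    (hΩ : IsOpen Ω) (hc : Convex ℝ Ω) : SigmaFinite (boundaryMeasure Ω) := by
  obtain ⟨A, hA, h⟩ := exists_boundaryMeasure_ball_le n
  refine ⟨⟨⟨fun k => Metric.ball 0 (k + 1), fun _ => trivial, fun k => ?_, ?_⟩⟩⟩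
  · exact (h Ω hΩ hc _ (by positivity)).trans_lt ENNReal.ofReal_lt_top
  · refine eq_univ_of_forall fun x => mem_iUnion.2 ?_
    obtain ⟨k, hk⟩ := exists_nat_gt ‖x‖
    exact ⟨k, mem_ball_zero_iff.2 (hk.trans (lt_add_one _))⟩

/-- On the layer `2ᵏ⁺¹ < |u| ≤ 2ᵏ⁺²` the difference `|u x - u y|` is at least `2ᵏ` for all `y`
outside the superlevel set `{|u| > 2ᵏ}`, so both energies control the density estimate for that set.
Summing over the disjoint layers loses nothing. -/
theorem exists_tsum_dyadicLayer_le (n : ℕ) (hn : 1 ≤ n) {α s p : ℝ} (hα : 0 < α) (hs : 0 < s)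
    (hp : 1 ≤ p) :
    ∃ c : ℝ, 0 < c ∧ ∀ Ω : Set (EuclideanSpace ℝ (Fin (n + 1))), IsOpen Ω → Convex ℝ Ω →
      ∀ u : EuclideanSpace ℝ (Fin (n + 1)) → ℝ, Measurable u →
        (∀ k, boundaryMeasure Ω (superlevel u k) ≠ ⊤) →
        ENNReal.ofReal c * ∑' k : ℤ, ((2 : ℝ≥0∞) ^ p) ^ k *
          (boundaryMeasure Ω (dyadicLayer u (k + 1)) *
            boundaryMeasure Ω (superlevel u k) ^ (-(s * p / n))) ≤
        gagliardoEnergy Ω s p u + curvatureEnergy Ω α s p u := by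
  have hp0 : 0 < p := by linarith
  obtain ⟨c, hc0, h⟩ := exists_measure_rpow_le_lintegral_compl_add n hn hα (mul_pos hs hp0)
  refine ⟨c, hc0, fun Ω hΩ hc u hu hfin => ?_⟩
  have := sigmaFinite_boundaryMeasure hΩ hc
  set μ := boundaryMeasure Ω with hμ
  set F : EuclideanSpace ℝ (Fin (n + 1)) → ℝ≥0∞ := fun x =>
    ∫⁻ y, ENNReal.ofReal (|u x - u y| ^ p / ‖x - y‖ ^ ((n : ℝ) + s * p)) ∂μ with hF
  set H : EuclideanSpace ℝ (Fin (n + 1)) → ℝ≥0∞ := fun x =>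
    (nonlocalMeanCurvature Ω α x).toENNReal ^ (s * p / α) * ENNReal.ofReal (|u x| ^ p) with hH
  have hFm : Measurable F := by
    refine Measurable.lintegral_prod_right' (f := fun z : EuclideanSpace ℝ (Fin (n + 1)) ×
      EuclideanSpace ℝ (Fin (n + 1)) =>
        ENNReal.ofReal (|u z.1 - u z.2| ^ p / ‖z.1 - z.2‖ ^ ((n : ℝ) + s * p))) ?_
    fun_prop
  have hsum : gagliardoEnergy Ω s p u + curvatureEnergy Ω α s p u = ∫⁻ x, F x + H x ∂μ :=
    (lintegral_add_left hFm H).symm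
  have hfr : ∀ᵐ x ∂μ, x ∈ frontier Ω := ae_restrict_mem isClosed_frontier.measurableSet
  rw [hsum, ← ENNReal.tsum_mul_left]
  refine le_trans ?_ (tsum_setLIntegral_dyadicLayer_le hu μ _)
  rw [← (Equiv.addRight (1 : ℤ)).tsum_eq fun k : ℤ => ∫⁻ x in dyadicLayer u k, F x + H x ∂μ]
  refine ENNReal.tsum_le_tsum fun k => ?_
  set A := superlevel u k with hA
  have hDA : dyadicLayer u (k + 1) ⊆ A :=
    (dyadicLayer_subset_superlevel u _).trans (superlevel_anti u (by simp))
  rcases eq_or_ne (μ (dyadicLayer u (k + 1))) 0 with hD0 | hD0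
  · simp [hD0]
  have hA0 : μ A ≠ 0 := fun h0 => hD0 (measure_mono_null hDA h0)
  have hAm : MeasurableSet A := measurableSet_superlevel hu k
  have hpt : ∀ᵐ x ∂μ, x ∈ dyadicLayer u (k + 1) →
      ((2 : ℝ≥0∞) ^ p) ^ k * (ENNReal.ofReal c * μ A ^ (-(s * p / n))) ≤ F x + H x := by
    filter_upwards [hfr] with x hx hxD
    have hux : (2 : ℝ) ^ (k + 1) < |u x| := hxD.1
    have h2k : (2 : ℝ) ^ (k + 1) = 2 ^ k + 2 ^ k := by rw [zpow_add_one₀ two_ne_zero]; ring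
    have h2k0 : (0 : ℝ) < 2 ^ k := by positivity
    refine le_trans (mul_le_mul' le_rfl (h Ω hΩ hc A hAm hA0 (hfin k) x hx (hDA hxD))) ?_
    rw [mul_add]
    refine add_le_add ?_ ?_
    · rw [← lintegral_const_mul _ (by fun_prop)]
      refine le_trans (setLIntegral_mono' hAm.compl fun y hy => ?_) (setLIntegral_le_lintegral Aᶜ _)
      have huy : |u y| ≤ 2 ^ k := not_lt.1 hy
      rw [← ofReal_two_zpow_rpow, ← ENNReal.ofReal_mul (by positivity), mul_one_div]
      refine ENNReal.ofReal_le_ofReal ?_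
      gcongr
      have := abs_sub_abs_le_abs_sub (u x) (u y)
      linarith
    · rw [hH, mul_comm]
      simp only
      rw [← ofReal_two_zpow_rpow]
      gcongr
      linarith
  calc _ = ∫⁻ _ in dyadicLayer u (k + 1),
        ((2 : ℝ≥0∞) ^ p) ^ k * (ENNReal.ofReal c * μ A ^ (-(s * p / n))) ∂μ := by
        rw [setLIntegral_const]; ring
    _ ≤ _ := setLIntegral_mono_ae' (measurableSet_dyadicLayer hu _) hpt

/-- The fractional Sobolev inequality in its sharp Lorentz form `L^{p*, p}`, written on dyadic
superlevel sets. -/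
theorem exists_tsum_superlevel_le (n : ℕ) (hn : 1 ≤ n) {α s p : ℝ} (hα : 0 < α) (hs : 0 < s)
    (hp : 1 ≤ p) (hsp : s * p < n) :
    ∃ C : ℝ≥0∞, C ≠ ⊤ ∧ ∀ Ω : Set (EuclideanSpace ℝ (Fin (n + 1))), IsOpen Ω → Convex ℝ Ω →
      ∀ u : EuclideanSpace ℝ (Fin (n + 1)) → ℝ, Measurable u →
        ∫⁻ x, ENNReal.ofReal (|u x| ^ p) ∂boundaryMeasure Ω ≠ ⊤ →
        ∑' k : ℤ, ((2 : ℝ≥0∞) ^ p) ^ k * boundaryMeasure Ω (superlevel u k) ^ (1 - s * p / n) ≤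
          C * (2⁻¹ * gagliardoEnergy Ω s p u + curvatureEnergy Ω α s p u) := by
  have hn0 : (0 : ℝ) < n := by exact_mod_cast hn
  have hp0 : 0 < p := by linarith
  obtain ⟨c, hc0, h⟩ := exists_tsum_dyadicLayer_le n hn hα hs hp
  have hb1 : 1 < (2 : ℝ≥0∞) ^ p := ENNReal.one_lt_rpow (by norm_num) hp0
  have hb : (2 : ℝ≥0∞) ^ p ≠ ⊤ := ENNReal.rpow_ne_top_of_nonneg hp0.le (by simp)
  have hε : 0 < s * p / n := by positivity
  obtain ⟨C, hC, hseq⟩ := exists_tsum_zpow_mul_rpow_le hb1 hb (θ := 1 - s * p / n)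
    (sub_pos.2 ((div_lt_one hn0).2 hsp)) (by linarith)
  refine ⟨C * (2 * (ENNReal.ofReal c)⁻¹), ENNReal.mul_ne_top hC
    (ENNReal.mul_ne_top (by simp) (ENNReal.inv_ne_top.2 (by simpa using hc0))),
    fun Ω hΩ hc u hu hup => ?_⟩
  have hcheb := zpow_mul_measure_superlevel_le hu (boundaryMeasure Ω) hp0
  have hfin : ∀ k, boundaryMeasure Ω (superlevel u k) ≠ ⊤ := fun k htop => by
    have := hcheb k
    rw [htop, ENNReal.mul_top (ENNReal.zpow_pos (zero_lt_one.trans hb1).ne' hb k).ne'] at this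
    exact hup (top_le_iff.1 this)
  have hmain := hseq (fun k => boundaryMeasure Ω (superlevel u k))
    (fun k => boundaryMeasure Ω (dyadicLayer u (k + 1)))
    (fun i j hij => measure_mono (superlevel_anti u hij))
    (fun k => by
      rw [measure_superlevel_eq_tsum hu]
      exact tsum_congr fun j => by congr 2; ring) _ hup hcheb
  have hlay := h Ω hΩ hc u hu hfin
  rw [sub_sub_cancel_left] at hmain
  refine hmain.trans ?_
  rw [mul_assoc]
  gcongr
  set T := ∑' k : ℤ, ((2 : ℝ≥0∞) ^ p) ^ k * (boundaryMeasure Ω (dyadicLayer u (k + 1)) *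
            boundaryMeasure Ω (superlevel u k) ^ (-(s * p / n)))
  have hc1 : ENNReal.ofReal c ≠ 0 := by simpa using hc0
  calc T = (ENNReal.ofReal c)⁻¹ * (ENNReal.ofReal c * T) := by
        rw [← mul_assoc, ENNReal.inv_mul_cancel hc1 ENNReal.ofReal_ne_top, one_mul]
    _ ≤ (ENNReal.ofReal c)⁻¹ *
        (2 * (2⁻¹ * gagliardoEnergy Ω s p u + curvatureEnergy Ω α s p u)) := by
        refine mul_le_mul' le_rfl (hlay.trans ?_)
        rw [mul_add, ← mul_assoc, ENNReal.mul_inv_cancel (by simp) (by simp), one_mul]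
        gcongr
        exact le_mul_of_one_le_left' one_le_two
    _ = _ := by ring

end Energy

/-! ### Integrals of powers of the norm -/

section PowerWeights

variable {X : Type*} [NormedAddCommGroup X] [MeasurableSpace X] [BorelSpace X]

/-- The volume growth of an `n`-dimensional surface: balls about the origin of radius `R` have
measure at most `A Rⁿ`. -/
def HasPolynomialGrowth (μ : Measure X) (n : ℕ) (A : ℝ) : Prop :=
  ∀ R : ℝ, 0 < R → μ (Metric.ball 0 R) ≤ ENNReal.ofReal (A * R ^ n)

variable {μ : Measure X} {n : ℕ} {A : ℝ}

theorem HasPolynomialGrowth.setLIntegral_shell_le (hA : 0 < A) (hμ : HasPolynomialGrowth μ n A)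
    {β r : ℝ} (hβ : 0 ≤ β) (hr : 0 < r) :
    ∫⁻ x in {x | r / 2 ≤ ‖x‖ ∧ ‖x‖ ≤ r}, ENNReal.ofReal (‖x‖ ^ (-β)) ∂μ ≤
      ENNReal.ofReal (A * 2 ^ n * 2 ^ β * r ^ (n - β)) := by
  set S : Set X := {x | r / 2 ≤ ‖x‖ ∧ ‖x‖ ≤ r} with hS
  have hSm : MeasurableSet S :=
    (measurableSet_le measurable_const measurable_norm).inter
      (measurableSet_le measurable_norm measurable_const)
  have hSμ : μ S ≤ ENNReal.ofReal (A * (2 * r) ^ n) := by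
    refine (measure_mono fun x hx => ?_).trans (hμ (2 * r) (by positivity))
    have := hx.2
    rw [mem_ball_zero_iff]
    linarith
  calc _ ≤ ∫⁻ _ in S, ENNReal.ofReal ((r / 2) ^ (-β)) ∂μ := by
        refine setLIntegral_mono' hSm fun x hx => ENNReal.ofReal_le_ofReal ?_
        exact Real.rpow_le_rpow_of_nonpos (by positivity) hx.1 (by linarith)
    _ = ENNReal.ofReal ((r / 2) ^ (-β)) * μ S := setLIntegral_const _ _
    _ ≤ ENNReal.ofReal ((r / 2) ^ (-β)) * ENNReal.ofReal (A * (2 * r) ^ n) := by gcongr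
    _ = _ := by
        rw [← ENNReal.ofReal_mul (by positivity), Real.div_rpow hr.le (by norm_num),
          Real.rpow_neg zero_le_two, Real.rpow_sub hr, Real.rpow_neg hr.le, mul_pow,
          Real.rpow_natCast]
        congr 1
        field_simp

theorem HasPolynomialGrowth.tsum_shell_le (hA : 0 < A) (hμ : HasPolynomialGrowth μ n A) {β : ℝ}
    (hβ : 0 ≤ β) {b R : ℝ} (hb : 0 < b) (hb1 : b ^ (n - β) < 1) (hR : 0 < R) :
    ∑' j : ℕ, ∫⁻ x in {x | b ^ j * R / 2 ≤ ‖x‖ ∧ ‖x‖ ≤ b ^ j * R},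
      ENNReal.ofReal (‖x‖ ^ (-β)) ∂μ ≤
      ENNReal.ofReal (A * 2 ^ n * 2 ^ β * (1 - b ^ (n - β))⁻¹ * R ^ (n - β)) := by
  have hb0 : 0 ≤ b ^ (n - β) := by positivity
  calc _ ≤ ∑' j : ℕ, ENNReal.ofReal (A * 2 ^ n * 2 ^ β * R ^ (n - β) * (b ^ (n - β)) ^ j) := by
        refine ENNReal.tsum_le_tsum fun j => ?_
        refine (hμ.setLIntegral_shell_le hA hβ (by positivity)).trans_eq ?_
        congr 1
        rw [Real.mul_rpow (by positivity) hR.le, ← Real.rpow_natCast b j, ← Real.rpow_mul hb.le,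
          mul_comm (j : ℝ), Real.rpow_mul hb.le, Real.rpow_natCast]
        ring
    _ = _ := by
        rw [← ENNReal.ofReal_tsum_of_nonneg (fun j => by positivity)
          ((summable_geometric_of_lt_one hb0 hb1).mul_left _), tsum_mul_left,
          tsum_geometric_of_lt_one hb0 hb1]
        congr 1
        ring

theorem HasPolynomialGrowth.setLIntegral_ball_le (hA : 0 < A) (hμ : HasPolynomialGrowth μ n A)
    {β R : ℝ} (hβ : 0 < β) (hβn : β < n) (hR : 0 < R) :
    ∫⁻ x in Metric.ball 0 R, ENNReal.ofReal (‖x‖ ^ (-β)) ∂μ ≤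
      ENNReal.ofReal (A * 2 ^ n * 2 ^ β * (1 - (1 / 2 : ℝ) ^ (n - β))⁻¹ * R ^ (n - β)) := by
  have hb1 : (1 / 2 : ℝ) ^ (n - β) < 1 :=
    Real.rpow_lt_one (by norm_num) (by norm_num) (by linarith)
  refine le_trans ?_ (hμ.tsum_shell_le hA hβ.le (by norm_num) hb1 hR)
  refine le_trans ?_ (lintegral_iUnion_le _ _)
  have hsub : Metric.ball (0 : X) R ⊆ {0} ∪
      ⋃ j : ℕ, {x | (1 / 2 : ℝ) ^ j * R / 2 ≤ ‖x‖ ∧ ‖x‖ ≤ (1 / 2 : ℝ) ^ j * R} := by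
    intro x hx
    rcases eq_or_ne x 0 with h0 | h0
    · exact Or.inl h0
    · right
      have hx' : ‖x‖ < R := mem_ball_zero_iff.1 hx
      obtain ⟨j, hj1, hj2⟩ := exists_nat_pow_near_of_lt_one (x := ‖x‖ / R) (y := 1 / 2)
        (by positivity) ((div_le_one hR).2 hx'.le) (by norm_num) (by norm_num)
      rw [lt_div_iff₀ hR, pow_succ] at hj1
      rw [div_le_iff₀ hR] at hj2
      exact mem_iUnion.2 ⟨j, by linarith, hj2⟩
  refine (lintegral_mono_set hsub).trans ((lintegral_union_le _ _ _).trans_eq ?_)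
  -- the weight vanishes at the origin, by the convention for powers of zero
  have h0 : ∫⁻ x in {(0 : X)}, ENNReal.ofReal (‖x‖ ^ (-β)) ∂μ = 0 := by
    rw [setLIntegral_congr_fun (g := fun _ => 0) (measurableSet_singleton _)]
    · simp
    · rintro x rfl
      simp [Real.zero_rpow (neg_ne_zero.2 hβ.ne')]
  rw [h0, zero_add]

theorem HasPolynomialGrowth.setLIntegral_compl_ball_le (hA : 0 < A)
    (hμ : HasPolynomialGrowth μ n A) {β R : ℝ} (hβn : n < β) (hR : 0 < R) :
    ∫⁻ x in (Metric.ball 0 R)ᶜ, ENNReal.ofReal (‖x‖ ^ (-β)) ∂μ ≤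
      ENNReal.ofReal (A * 2 ^ n * 2 ^ β * (1 - (2 : ℝ) ^ (n - β))⁻¹ * (2 * R) ^ (n - β)) := by
  have hb1 : (2 : ℝ) ^ (n - β) < 1 :=
    Real.rpow_lt_one_of_one_lt_of_neg (by norm_num) (by linarith)
  have hβ : 0 ≤ β := (Nat.cast_nonneg n).trans hβn.le
  refine le_trans ?_ (hμ.tsum_shell_le hA hβ (by norm_num) hb1 (by positivity))
  refine le_trans ?_ (lintegral_iUnion_le _ _)
  refine lintegral_mono_set fun x hx => ?_
  have hx' : R ≤ ‖x‖ := by simpa using hx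
  obtain ⟨j, hj1, hj2⟩ := exists_nat_pow_near (x := ‖x‖ / R) (y := 2)
    ((one_le_div hR).2 hx') (by norm_num)
  rw [le_div_iff₀ hR] at hj1
  rw [div_lt_iff₀ hR, pow_succ] at hj2
  exact mem_iUnion.2 ⟨j, by linarith, by linarith⟩

/-- Among sets of given measure, the integral of a decreasing power of the norm is largest, up to a
constant, on a ball about the origin. -/
theorem exists_setLIntegral_le_measure_rpow (n : ℕ) (hn : 1 ≤ n) (hA : 0 < A) {β : ℝ} (hβ : 0 ≤ β)
    (hβn : β < n) :
    ∃ C : ℝ≥0∞, C ≠ ⊤ ∧ ∀ μ : Measure X, HasPolynomialGrowth μ n A → ∀ S : Set X, μ S ≠ ⊤ →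
      ∫⁻ x in S, ENNReal.ofReal (‖x‖ ^ (-β)) ∂μ ≤ C * μ S ^ (1 - β / n) := by
  have hn0 : (0 : ℝ) < n := by exact_mod_cast hn
  rcases hβ.eq_or_lt with rfl | hβ0
  · exact ⟨1, by simp, fun μ _ S _ => by simp⟩
  set K : ℝ := A * 2 ^ n * 2 ^ β * (1 - (1 / 2 : ℝ) ^ (n - β))⁻¹ with hK
  have hK0 : 0 < K := by
    have : (1 / 2 : ℝ) ^ (n - β) < 1 := Real.rpow_lt_one (by norm_num) (by norm_num) (by linarith)
    have := sub_pos.2 this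
    positivity
  refine ⟨ENNReal.ofReal (K + 1), ENNReal.ofReal_ne_top, fun μ hμ S hS => ?_⟩
  rcases eq_or_ne (μ S) 0 with hS0 | hS0
  · rw [Measure.restrict_eq_zero.2 hS0]
    simp
  set m : ℝ := (μ S).toReal with hm
  have hm0 : 0 < m := ENNReal.toReal_pos hS0 hS
  have hmS : μ S = ENNReal.ofReal m := (ENNReal.ofReal_toReal hS).symm
  set R : ℝ := m ^ (1 / (n : ℝ)) with hR
  have hR0 : 0 < R := by positivity
  have hRp : ∀ z : ℝ, R ^ z = m ^ (z / n) := fun z => by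
    rw [hR, ← Real.rpow_mul hm0.le]
    congr 1
    ring
  have h1 : ∫⁻ x in S ∩ Metric.ball 0 R, ENNReal.ofReal (‖x‖ ^ (-β)) ∂μ ≤
      ENNReal.ofReal (K * m ^ (1 - β / n)) := by
    refine (lintegral_mono_set inter_subset_right).trans
      ((hμ.setLIntegral_ball_le hA hβ0 hβn hR0).trans_eq ?_)
    rw [hRp, sub_div, div_self hn0.ne']
  have h2 : ∫⁻ x in S \ Metric.ball 0 R, ENNReal.ofReal (‖x‖ ^ (-β)) ∂μ ≤
      ENNReal.ofReal (m ^ (1 - β / n)) := by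
    calc _ ≤ ∫⁻ _ in S \ Metric.ball 0 R, ENNReal.ofReal (R ^ (-β)) ∂μ := by
          refine setLIntegral_mono_ae aemeasurable_const (Eventually.of_forall fun x hx => ?_)
          refine ENNReal.ofReal_le_ofReal (Real.rpow_le_rpow_of_nonpos hR0 ?_ (by linarith))
          simpa using hx.2
      _ = ENNReal.ofReal (R ^ (-β)) * μ (S \ Metric.ball 0 R) := setLIntegral_const _ _
      _ ≤ ENNReal.ofReal (R ^ (-β)) * ENNReal.ofReal m := by
          rw [← hmS]
          gcongr
          exact sdiff_subset
      _ = _ := by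
          rw [← ENNReal.ofReal_mul (by positivity), hRp, ← Real.rpow_add_one hm0.ne']
          congr 2
          ring
  rw [← lintegral_inter_add_sdiff _ S (Metric.isOpen_ball (x := (0 : X)) (ε := R)).measurableSet,
    hmS, ENNReal.ofReal_rpow_of_pos hm0, ← ENNReal.ofReal_mul (by positivity), add_mul, one_mul,
    ENNReal.ofReal_add (by positivity) (by positivity)]
  exact add_le_add h1 h2

end PowerWeights

theorem tsum_rpow_le_rpow_tsum {ι : Type*} (f : ι → ℝ≥0∞) {r : ℝ} (hr : 1 ≤ r) :
    ∑' i, f i ^ r ≤ (∑' i, f i) ^ r := by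
  have hsplit : ∀ x : ℝ≥0∞, x ^ r = x * x ^ (r - 1) := fun x => by
    have := ENNReal.rpow_add_of_nonneg (x := x) 1 (r - 1) zero_le_one (by linarith)
    rwa [add_sub_cancel, ENNReal.rpow_one] at this
  calc ∑' i, f i ^ r ≤ ∑' i, f i * (∑' i, f i) ^ (r - 1) := by
        refine ENNReal.tsum_le_tsum fun i => ?_
        rw [hsplit]
        exact mul_le_mul' le_rfl (ENNReal.rpow_le_rpow (ENNReal.le_tsum i) (by linarith))
    _ = _ := by rw [ENNReal.tsum_mul_right, ← hsplit]

/-! ### Hardy–Sobolev inequalities -/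

section WeightedSobolev

/-- The sum of the Gagliardo energy and the curvature energy, which is homogeneous of degree `p` in
`u`. -/
noncomputable def totalEnergy {n : ℕ} (Ω : Set (EuclideanSpace ℝ (Fin (n + 1)))) (α s p : ℝ)
    (u : EuclideanSpace ℝ (Fin (n + 1)) → ℝ) : ℝ≥0∞ :=
  2⁻¹ * gagliardoEnergy Ω s p u + curvatureEnergy Ω α s p u

/-- The fractional Hardy–Sobolev inequality on convex hypersurfaces; `β = 0` is the Sobolev
inequality and `β = s p`, `t = p` is the Hardy inequality. -/
theorem exists_lintegral_weight_le_totalEnergy (n : ℕ) (hn : 1 ≤ n) {α s p β t : ℝ} (hα : 0 < α)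
    (hs : 0 < s) (hp : 1 ≤ p) (hsp : s * p < n) (hβ : 0 ≤ β) (hβn : β < n) (hpt : p ≤ t)
    (hbal : t / p * (1 - s * p / n) = 1 - β / n) :
    ∃ C : ℝ≥0∞, C ≠ ⊤ ∧ ∀ Ω : Set (EuclideanSpace ℝ (Fin (n + 1))), IsOpen Ω → Convex ℝ Ω →
      ∀ u : EuclideanSpace ℝ (Fin (n + 1)) → ℝ, Measurable u →
        ∫⁻ x, ENNReal.ofReal (|u x| ^ p) ∂boundaryMeasure Ω ≠ ⊤ →
        ∫⁻ x, ENNReal.ofReal (‖x‖ ^ (-β)) * ENNReal.ofReal (|u x| ^ t) ∂boundaryMeasure Ω ≤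
          C * totalEnergy Ω α s p u ^ (t / p) := by
  have hp0 : 0 < p := by linarith
  have ht0 : 0 < t := by linarith
  have hr : 1 ≤ t / p := (one_le_div hp0).2 hpt
  obtain ⟨A, hA, hgrowth⟩ := exists_boundaryMeasure_ball_le n
  obtain ⟨B, hB, hbath⟩ := exists_setLIntegral_le_measure_rpow
    (X := EuclideanSpace ℝ (Fin (n + 1))) n hn hA hβ hβn
  obtain ⟨C, hC, hsob⟩ := exists_tsum_superlevel_le n hn hα hs hp hsp
  refine ⟨ENNReal.ofReal (2 ^ t) * B * C ^ (t / p), ENNReal.mul_ne_top (ENNReal.mul_ne_top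
    ENNReal.ofReal_ne_top hB) (ENNReal.rpow_ne_top_of_nonneg (by positivity) hC),
    fun Ω hΩ hc u hu hup => ?_⟩
  set μ := boundaryMeasure Ω with hμ
  have hb0 : (2 : ℝ≥0∞) ^ p ≠ 0 := by simp [ENNReal.rpow_eq_zero_iff]
  have hb : (2 : ℝ≥0∞) ^ p ≠ ⊤ := ENNReal.rpow_ne_top_of_nonneg hp0.le (by simp)
  have hfin : ∀ k, μ (superlevel u k) ≠ ⊤ := fun k htop => by
    have := zpow_mul_measure_superlevel_le hu μ hp0 k
    rw [htop, ENNReal.mul_top (ENNReal.zpow_pos hb0 hb k).ne'] at this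
    exact hup (top_le_iff.1 this)
  rw [lintegral_eq_tsum_dyadicLayer hu μ fun x hx => by simp [hx, Real.zero_rpow ht0.ne']]
  have hlayer : ∀ k : ℤ, ∫⁻ x in dyadicLayer u k,
      ENNReal.ofReal (‖x‖ ^ (-β)) * ENNReal.ofReal (|u x| ^ t) ∂μ ≤
      ENNReal.ofReal (2 ^ t) * B *
        (((2 : ℝ≥0∞) ^ p) ^ k * μ (superlevel u k) ^ (1 - s * p / n)) ^ (t / p) := by
    intro k
    calc _ ≤ ∫⁻ x in dyadicLayer u k,
          ENNReal.ofReal (‖x‖ ^ (-β)) * ENNReal.ofReal (((2 : ℝ) ^ (k + 1)) ^ t) ∂μ := by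
          refine setLIntegral_mono' (measurableSet_dyadicLayer hu k) fun x hx => ?_
          gcongr
          exact hx.2
      _ = (∫⁻ x in dyadicLayer u k, ENNReal.ofReal (‖x‖ ^ (-β)) ∂μ) *
          ENNReal.ofReal (((2 : ℝ) ^ (k + 1)) ^ t) := lintegral_mul_const _ (by fun_prop)
      _ ≤ (B * μ (superlevel u k) ^ (1 - β / n)) * ENNReal.ofReal (((2 : ℝ) ^ (k + 1)) ^ t) := by
          gcongr
          exact (lintegral_mono_set (dyadicLayer_subset_superlevel u k)).trans
            (hbath μ (hgrowth Ω hΩ hc) _ (hfin k))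
      _ = _ := by
          rw [ENNReal.mul_rpow_of_nonneg _ _ (by positivity : 0 ≤ t / p), ← ENNReal.rpow_mul,
            mul_comm _ (t / p), hbal, zpow_add_one₀ two_ne_zero,
            Real.mul_rpow (by positivity) (by norm_num), ENNReal.ofReal_mul (by positivity),
            ofReal_two_zpow_rpow, ← ENNReal.rpow_intCast, ← ENNReal.rpow_intCast,
            ← ENNReal.rpow_mul, ← ENNReal.rpow_mul, ← ENNReal.rpow_mul]
          have : p * (((k : ℤ) : ℝ) * (t / p)) = t * k := by field_simp
          rw [this]
          ring
  refine (ENNReal.tsum_le_tsum hlayer).trans ?_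
  rw [ENNReal.tsum_mul_left, mul_assoc _ (C ^ (t / p)),
    ← ENNReal.mul_rpow_of_nonneg _ _ (by positivity : 0 ≤ t / p)]
  gcongr
  refine (tsum_rpow_le_rpow_tsum _ hr).trans ?_
  gcongr
  exact hsob Ω hΩ hc u hu hup

end WeightedSobolev

/-! ### Hölder inequalities with weights -/

section Interpolation

/-- The integral `∫ |x|^(γ τ) |u|^τ dμ`, the `τ`-th power of the weighted norm of `u`. -/
noncomputable def weightedIntegral {n : ℕ} (μ : Measure (EuclideanSpace ℝ (Fin (n + 1))))
    (γ τ : ℝ) (u : EuclideanSpace ℝ (Fin (n + 1)) → ℝ) : ℝ≥0∞ :=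
  ∫⁻ x, ENNReal.ofReal (‖x‖ ^ (γ * τ)) * ENNReal.ofReal (|u x| ^ τ) ∂μ

variable {n : ℕ} {u : EuclideanSpace ℝ (Fin (n + 1)) → ℝ}

theorem eLpNorm_weight_mul_eq (μ : Measure (EuclideanSpace ℝ (Fin (n + 1)))) {γ τ : ℝ}
    (hτ : 0 < τ) :
    eLpNorm (fun x => ‖x‖ ^ γ * u x) (ENNReal.ofReal τ) μ = weightedIntegral μ γ τ u ^ (1 / τ) := by
  rw [eLpNorm_eq_lintegral_rpow_enorm_toReal (by simpa using hτ) ENNReal.ofReal_ne_top,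
    ENNReal.toReal_ofReal hτ.le, weightedIntegral]
  congr 1
  refine lintegral_congr fun x => ?_
  rw [Real.enorm_eq_ofReal_abs, ENNReal.ofReal_rpow_of_nonneg (abs_nonneg _) hτ.le, abs_mul,
    Real.mul_rpow (abs_nonneg _) (abs_nonneg _), ENNReal.ofReal_mul (by positivity),
    abs_of_nonneg (by positivity : 0 ≤ ‖x‖ ^ γ), ← Real.rpow_mul (norm_nonneg x)]

theorem eLpNorm_eq_rpow_lintegral (μ : Measure (EuclideanSpace ℝ (Fin (n + 1)))) {q : ℝ}
    (hq : 0 < q) :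
    eLpNorm u (ENNReal.ofReal q) μ = (∫⁻ x, ENNReal.ofReal (|u x| ^ q) ∂μ) ^ (1 / q) := by
  have := eLpNorm_weight_mul_eq (u := u) μ (γ := 0) hq
  simpa [weightedIntegral] using this

/-- Hölder's inequality for the factorization
`|x|^γ |u| = (|x|^σ |u|)^a |u|^(1 - a) |x|^(γ - a σ)`. -/
theorem weightedIntegral_le_mul_mul (μ ν : Measure (EuclideanSpace ℝ (Fin (n + 1))))
    (hν : ν ≤ μ) (hu : Measurable u) {a σ γ t q τ r : ℝ} (ha0 : 0 < a) (ha1 : a < 1)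
    (ht : 0 < t) (hq : 0 < q) (hτ : 0 < τ) (hr : 0 < r) (hσ : σ < 0) (hγ : γ - a * σ < 0)
    (hbal : 1 / τ = a / t + (1 - a) / q + 1 / r) :
    weightedIntegral ν γ τ u ≤
      weightedIntegral μ σ t u ^ (a * τ / t) *
        (∫⁻ x, ENNReal.ofReal (|u x| ^ q) ∂μ) ^ ((1 - a) * τ / q) *
        (∫⁻ x, ENNReal.ofReal (‖x‖ ^ ((γ - a * σ) * r)) ∂ν) ^ (τ / r) := by
  have ha1' : 0 < 1 - a := sub_pos.2 ha1
  have h := ENNReal.lintegral_prod_norm_pow_le (μ := ν) Finset.univ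
    (f := ![fun x => ENNReal.ofReal (‖x‖ ^ (σ * t)) * ENNReal.ofReal (|u x| ^ t),
      fun x => ENNReal.ofReal (|u x| ^ q), fun x => ENNReal.ofReal (‖x‖ ^ ((γ - a * σ) * r))])
    (p := ![a * τ / t, (1 - a) * τ / q, τ / r]) ?_ ?_ ?_
  · simp only [Fin.prod_univ_three, Matrix.cons_val_zero, Matrix.cons_val_one,
      Matrix.cons_val] at h
    refine le_trans (le_of_eq ?_) (h.trans ?_)
    · refine lintegral_congr fun x => ?_
      have e1 : σ * t * (a * τ / t) = a * σ * τ := by field_simp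
      have e2 : t * (a * τ / t) = a * τ := by field_simp
      have e3 : q * ((1 - a) * τ / q) = (1 - a) * τ := by field_simp
      have e4 : (γ - a * σ) * r * (τ / r) = (γ - a * σ) * τ := by field_simp
      rw [← ENNReal.ofReal_mul (by positivity), ← ENNReal.ofReal_mul (by positivity),
        ENNReal.ofReal_rpow_of_nonneg (by positivity) (by positivity),
        ENNReal.ofReal_rpow_of_nonneg (by positivity) (by positivity),
        ENNReal.ofReal_rpow_of_nonneg (by positivity) (by positivity),
        ← ENNReal.ofReal_mul (by positivity), ← ENNReal.ofReal_mul (by positivity),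
        Real.mul_rpow (by positivity) (by positivity), ← Real.rpow_mul (norm_nonneg x),
        ← Real.rpow_mul (norm_nonneg x), ← Real.rpow_mul (abs_nonneg _),
        ← Real.rpow_mul (abs_nonneg _), e1, e2, e3, e4]
      congr 1
      have hu' : |u x| ^ τ = |u x| ^ (a * τ) * |u x| ^ ((1 - a) * τ) := by
        rw [← Real.rpow_add_of_nonneg (abs_nonneg _) (by positivity) (by positivity)]
        congr 1
        ring
      have hx' : ‖x‖ ^ (γ * τ) = ‖x‖ ^ (a * σ * τ) * ‖x‖ ^ ((γ - a * σ) * τ) := by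
        rcases eq_or_ne x 0 with rfl | hx
        · have haσ : a * σ < 0 := mul_neg_of_pos_of_neg ha0 hσ
          have : γ * τ ≠ 0 := mul_ne_zero (by linarith) hτ.ne'
          rw [norm_zero, Real.zero_rpow this,
            Real.zero_rpow (mul_ne_zero hγ.ne hτ.ne'), mul_zero]
        · rw [← Real.rpow_add (norm_pos_iff.2 hx)]
          congr 1
          ring
      rw [hu', hx']
      ring
    · refine mul_le_mul' (mul_le_mul' ?_ ?_) le_rfl
      · exact ENNReal.rpow_le_rpow (lintegral_mono' hν le_rfl) (by positivity)
      · exact ENNReal.rpow_le_rpow (lintegral_mono' hν le_rfl) (by positivity)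
  · intro i _
    fin_cases i
    · exact (by fun_prop : Measurable fun x : EuclideanSpace ℝ (Fin (n + 1)) =>
        ENNReal.ofReal (‖x‖ ^ (σ * t)) * ENNReal.ofReal (|u x| ^ t)).aemeasurable
    · exact (by fun_prop : Measurable fun x : EuclideanSpace ℝ (Fin (n + 1)) =>
        ENNReal.ofReal (|u x| ^ q)).aemeasurable
    · exact (by fun_prop : Measurable fun x : EuclideanSpace ℝ (Fin (n + 1)) =>
        ENNReal.ofReal (‖x‖ ^ ((γ - a * σ) * r))).aemeasurable
  · simp only [Fin.sum_univ_three, Matrix.cons_val_zero, Matrix.cons_val_one, Matrix.cons_val]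
    have : (1 / τ) * τ = (a / t + (1 - a) / q + 1 / r) * τ := by rw [hbal]
    rw [one_div_mul_cancel hτ.ne'] at this
    refine Eq.trans ?_ this.symm
    ring
  · intro i _
    fin_cases i
    · change 0 ≤ a * τ / t
      positivity
    · change 0 ≤ (1 - a) * τ / q
      positivity
    · change 0 ≤ τ / r
      positivity

/-- Hölder's inequality for the factorization `|x|^γ |u| = (|x|^(γ / a) |u|)^a |u|^(1 - a)`. -/
theorem weightedIntegral_le_mul (μ : Measure (EuclideanSpace ℝ (Fin (n + 1))))
    (hu : Measurable u) {a γ t q τ : ℝ} (ha0 : 0 < a) (ha1 : a ≤ 1)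
    (ht : 0 < t) (hq : 0 < q) (hτ : 0 < τ) (hbal : 1 / τ = a / t + (1 - a) / q) :
    weightedIntegral μ γ τ u ≤ weightedIntegral μ (γ / a) t u ^ (a * τ / t) *
        (∫⁻ x, ENNReal.ofReal (|u x| ^ q) ∂μ) ^ ((1 - a) * τ / q) := by
  have ha1' : 0 ≤ 1 - a := sub_nonneg.2 ha1
  have hsum : a * τ / t + (1 - a) * τ / q = 1 := by
    have : (1 / τ) * τ = (a / t + (1 - a) / q) * τ := by rw [hbal]
    rw [one_div_mul_cancel hτ.ne'] at this
    refine Eq.trans ?_ this.symm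
    ring
  have h := ENNReal.lintegral_mul_norm_pow_le (μ := μ)
    (f := fun x => ENNReal.ofReal (‖x‖ ^ (γ / a * t)) * ENNReal.ofReal (|u x| ^ t))
    (g := fun x => ENNReal.ofReal (|u x| ^ q))
    (Measurable.aemeasurable (by fun_prop)) (Measurable.aemeasurable (by fun_prop))
    (by positivity) (by positivity) hsum
  refine le_trans (le_of_eq ?_) h
  refine lintegral_congr fun x => ?_
  have e1 : γ / a * t * (a * τ / t) = γ * τ := by field_simp
  have e2 : t * (a * τ / t) = a * τ := by field_simp
  have e3 : q * ((1 - a) * τ / q) = (1 - a) * τ := by field_simp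
  rw [← ENNReal.ofReal_mul (by positivity), ← ENNReal.ofReal_mul (by positivity),
    ENNReal.ofReal_rpow_of_nonneg (by positivity) (by positivity),
    ENNReal.ofReal_rpow_of_nonneg (by positivity) (by positivity),
    ← ENNReal.ofReal_mul (by positivity),
    Real.mul_rpow (by positivity) (by positivity), ← Real.rpow_mul (norm_nonneg x),
    ← Real.rpow_mul (abs_nonneg _), ← Real.rpow_mul (abs_nonneg _), e1, e2, e3, mul_assoc,
    ← Real.rpow_add_of_nonneg (abs_nonneg _) (by positivity) (by positivity)]
  congr 3
  ring

end Interpolation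

/-! ### Moderately singular weights -/

section Regimes

/-- The estimate claimed by the theorem, for the `τ`-th powers of the norms and with the energies
abbreviated. -/
def InterpolationInequality (n : ℕ) (a α s γ p q τ : ℝ) : Prop :=
  ∃ C : ℝ≥0∞, C ≠ ⊤ ∧ ∀ Ω : Set (EuclideanSpace ℝ (Fin (n + 1))), IsOpen Ω → Convex ℝ Ω →
    ∀ u : EuclideanSpace ℝ (Fin (n + 1)) → ℝ, Measurable u →
      ∫⁻ x, ENNReal.ofReal (|u x| ^ p) ∂boundaryMeasure Ω ≠ ⊤ →
      weightedIntegral (boundaryMeasure Ω) γ τ u ≤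
        C * totalEnergy Ω α s p u ^ (a * τ / p) *
          (∫⁻ x, ENNReal.ofReal (|u x| ^ q) ∂boundaryMeasure Ω) ^ ((1 - a) * τ / q)

variable {n : ℕ} {a α s γ p q τ : ℝ}

/-- For weights not more singular than `|x|^(-a s)` the inequality is an interpolation between the
Hardy–Sobolev inequality and `L^q`. -/
theorem interpolationInequality_of_neg_mul_le (hn : 1 ≤ n) (ha0 : 0 < a) (ha1 : a ≤ 1)
    (hα : 0 < α) (hs : 0 < s) (hγ : γ ≤ 0) (hp : 1 ≤ p) (hq : 0 < q) (hτ : 0 < τ) (hsp : s * p < n)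
    (hbal : 1 / τ + γ / n = a * (1 / p - s / n) + (1 - a) / q) (hγs : -(a * s) ≤ γ) :
    InterpolationInequality n a α s γ p q τ := by
  have hn0 : (0 : ℝ) < n := by exact_mod_cast hn
  have hp0 : 0 < p := by linarith
  have hstar : 0 < 1 / p - s / n := by
    rw [sub_pos, div_lt_div_iff₀ hn0 hp0]
    linarith
  have hγa : 0 ≤ -γ / a := div_nonneg (by linarith) ha0.le
  have hγas : -γ / a ≤ s := by rw [div_le_iff₀ ha0]; linarith
  -- `t` is the exponent of the Hardy–Sobolev inequality with the weight `|x|^(γ / a)`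
  set T : ℝ := 1 / p - s / n + -γ / a / n with hT
  have hT0 : 0 < T := by positivity
  have hTp : T ≤ 1 / p := by
    have : -γ / a / n ≤ s / n := by gcongr
    linarith
  set t : ℝ := 1 / T with ht
  have ht0 : 0 < t := by positivity
  have hpt : p ≤ t := by
    rw [ht, le_one_div hp0 hT0]
    exact hTp
  have htT : t * T = 1 := one_div_mul_cancel hT0.ne'
  set β : ℝ := -γ / a * t with hβ
  have hβ0 : 0 ≤ β := by positivity
  have hβn' : 1 - β / n = t * (1 / p - s / n) := by
    have : t * T = t * (1 / p - s / n) + β / n := by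
      rw [hT, hβ]
      ring
    linarith
  have hβn : β < n := by
    have : 0 < 1 - β / n := by rw [hβn']; positivity
    rw [sub_pos, div_lt_one hn0] at this
    exact this
  obtain ⟨C, hC, h⟩ := exists_lintegral_weight_le_totalEnergy n hn hα hs hp hsp hβ0 hβn hpt (by
    rw [hβn']
    field_simp)
  refine ⟨C ^ (a * τ / t), ENNReal.rpow_ne_top_of_nonneg (by positivity) hC,
    fun Ω hΩ hc u hu hup => ?_⟩
  have hW : weightedIntegral (boundaryMeasure Ω) (γ / a) t u ≤
      C * totalEnergy Ω α s p u ^ (t / p) := by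
    have := h Ω hΩ hc u hu hup
    have hβe : -β = γ / a * t := by rw [hβ]; ring
    rwa [hβe] at this
  have hbal' : 1 / τ = a / t + (1 - a) / q := by
    have h1 : a / t = a * T := by rw [ht]; field_simp
    have h2 : a * T = a * (1 / p - s / n) - γ / n := by
      rw [hT]
      field_simp
      ring
    rw [h1, h2]
    linarith
  refine (weightedIntegral_le_mul _ hu ha0 ha1 ht0 hq hτ hbal').trans ?_
  gcongr
  refine (ENNReal.rpow_le_rpow hW (by positivity)).trans_eq ?_
  rw [ENNReal.mul_rpow_of_nonneg _ _ (by positivity), ← ENNReal.rpow_mul]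
  congr 2
  field_simp

/-- The bound on a part of `∂Ω`, in terms of the integral of the left-over weight there. -/
theorem exists_weightedIntegral_restrict_le (hn : 1 ≤ n) {b r : ℝ} (hb0 : 0 < b) (hb1 : b < 1)
    (hα : 0 < α) (hs : 0 < s) (hp : 1 ≤ p) (hq : 0 < q) (hτ : 0 < τ) (hr : 0 < r)
    (hsp : s * p < n) (hγ : γ + b * s < 0) (hbal : 1 / τ = b / p + (1 - b) / q + 1 / r) :
    ∃ C : ℝ≥0∞, C ≠ ⊤ ∧ ∀ Ω : Set (EuclideanSpace ℝ (Fin (n + 1))), IsOpen Ω → Convex ℝ Ω →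
      ∀ u : EuclideanSpace ℝ (Fin (n + 1)) → ℝ, Measurable u →
        ∫⁻ x, ENNReal.ofReal (|u x| ^ p) ∂boundaryMeasure Ω ≠ ⊤ →
        ∀ S : Set (EuclideanSpace ℝ (Fin (n + 1))),
          weightedIntegral ((boundaryMeasure Ω).restrict S) γ τ u ≤
            C * totalEnergy Ω α s p u ^ (b * τ / p) *
              (∫⁻ x, ENNReal.ofReal (|u x| ^ q) ∂boundaryMeasure Ω) ^ ((1 - b) * τ / q) *
              (∫⁻ x in S, ENNReal.ofReal (‖x‖ ^ ((γ + b * s) * r)) ∂boundaryMeasure Ω) ^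
                (τ / r) := by
  have hp0 : 0 < p := by linarith
  obtain ⟨C, hC, h⟩ := exists_lintegral_weight_le_totalEnergy n hn hα hs hp hsp
    (β := s * p) (t := p) (by positivity) hsp le_rfl (by rw [div_self hp0.ne', one_mul])
  refine ⟨C ^ (b * τ / p), ENNReal.rpow_ne_top_of_nonneg (by positivity) hC,
    fun Ω hΩ hc u hu hup S => ?_⟩
  have hW : weightedIntegral (boundaryMeasure Ω) (-s) p u ≤ C * totalEnergy Ω α s p u := by
    have := h Ω hΩ hc u hu hup
    rwa [div_self hp0.ne', ENNReal.rpow_one, ← neg_mul] at this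
  have hγ' : γ - b * -s = γ + b * s := by ring
  have := weightedIntegral_le_mul_mul (boundaryMeasure Ω) ((boundaryMeasure Ω).restrict S)
    Measure.restrict_le_self hu hb0 hb1 hp0 hq hτ hr (neg_neg_of_pos hs) (hγ' ▸ hγ) hbal
  rw [hγ'] at this
  refine this.trans ?_
  gcongr
  rw [← ENNReal.mul_rpow_of_nonneg _ _ (by positivity)]
  exact ENNReal.rpow_le_rpow hW (by positivity)

end Regimes

/-! ### Strongly singular weights -/

section SingularWeights

variable {n : ℕ} {a α s γ p q τ : ℝ}

/-- `R ^ (n (a - b) D)` turns the exponents `b`, `1 - b` into `a`, `1 - a` when `R` balances the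
energy against the `L^q` norm. -/
theorem rpow_mul_rpow_mul_radius {e Q D N b : ℝ} (he : 0 < e) (hQ : 0 < Q) (hD : D ≠ 0)
    (hN : N ≠ 0) :
    e ^ (b * τ) * Q ^ ((1 - b) * τ) * ((e / Q) ^ (1 / (N * D))) ^ (N * ((a - b) * D) * τ) =
      e ^ (a * τ) * Q ^ ((1 - a) * τ) := by
  have h1 : 1 / (N * D) * (N * ((a - b) * D) * τ) = (a - b) * τ := by field_simp
  rw [← Real.rpow_mul (by positivity), h1, Real.div_rpow he.le hQ.le, div_eq_mul_inv,
    ← Real.rpow_neg hQ.le]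
  calc _ = (e ^ (b * τ) * e ^ ((a - b) * τ)) * (Q ^ ((1 - b) * τ) * Q ^ (-((a - b) * τ))) := by
        ring
    _ = _ := by
        rw [← Real.rpow_add he, ← Real.rpow_add hQ]
        congr 2 <;> ring

/-- The bound on the ball `B_R` (for `(a - b) D > 0`) or on its complement (for `(a - b) D < 0`),
where `D = 1 / p* - 1 / q`. -/
theorem exists_weightedIntegral_region_le (hn : 1 ≤ n) {b r D : ℝ} (hb0 : 0 < b) (hb1 : b < 1)
    (hα : 0 < α) (hs : 0 < s) (hp : 1 ≤ p) (hq : 0 < q) (hτ : 0 < τ) (hr : 0 < r)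
    (hsp : s * p < n) (hγ : γ + b * s < 0) (hbal : 1 / τ = b / p + (1 - b) / q + 1 / r)
    (hscale : n / r + (γ + b * s) = n * ((a - b) * D)) (hD : (a - b) * D ≠ 0) :
    ∃ C : ℝ≥0∞, C ≠ ⊤ ∧ ∀ Ω : Set (EuclideanSpace ℝ (Fin (n + 1))), IsOpen Ω → Convex ℝ Ω →
      ∀ u : EuclideanSpace ℝ (Fin (n + 1)) → ℝ, Measurable u →
        ∫⁻ x, ENNReal.ofReal (|u x| ^ p) ∂boundaryMeasure Ω ≠ ⊤ → ∀ R : ℝ, 0 < R →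
          weightedIntegral ((boundaryMeasure Ω).restrict
              (if 0 < (a - b) * D then Metric.ball 0 R else (Metric.ball 0 R)ᶜ)) γ τ u ≤
            C * (totalEnergy Ω α s p u ^ (b * τ / p) *
              (∫⁻ x, ENNReal.ofReal (|u x| ^ q) ∂boundaryMeasure Ω) ^ ((1 - b) * τ / q) *
              ENNReal.ofReal (R ^ (n * ((a - b) * D) * τ))) := by
  have hn0 : (0 : ℝ) < n := by exact_mod_cast hn
  obtain ⟨A, hA, hgrowth⟩ := exists_boundaryMeasure_ball_le n
  obtain ⟨C, hC, h⟩ := exists_weightedIntegral_restrict_le hn hb0 hb1 hα hs hp hq hτ hr hsp hγ hbal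
  set β : ℝ := -((γ + b * s) * r) with hβ
  have hβ0 : 0 < β := neg_pos.2 (mul_neg_of_neg_of_pos hγ hr)
  have hnβ : n - β = n * ((a - b) * D) * r := by
    rw [← hscale, hβ]
    field_simp
    ring
  obtain ⟨K, hK, hweight⟩ : ∃ K : ℝ, 0 ≤ K ∧ ∀ Ω : Set (EuclideanSpace ℝ (Fin (n + 1))),
      IsOpen Ω → Convex ℝ Ω → ∀ R : ℝ, 0 < R →
        ∫⁻ x in (if 0 < (a - b) * D then Metric.ball 0 R else (Metric.ball 0 R)ᶜ),
          ENNReal.ofReal (‖x‖ ^ (-β)) ∂boundaryMeasure Ω ≤ ENNReal.ofReal (K * R ^ (n - β)) := by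
    split_ifs with hpos
    · have hβn : β < n := by
        have : 0 < n * ((a - b) * D) * r := by positivity
        linarith
      refine ⟨_, ?_, fun Ω hΩ hc R hR =>
        HasPolynomialGrowth.setLIntegral_ball_le hA (hgrowth Ω hΩ hc) hβ0 hβn hR⟩
      have : (1 / 2 : ℝ) ^ (n - β) < 1 :=
        Real.rpow_lt_one (by norm_num) (by norm_num) (by linarith)
      have := sub_pos.2 this
      positivity
    · have hneg : (a - b) * D < 0 := lt_of_le_of_ne (not_lt.1 hpos) hD
      have hβn : n < β := by
        have : n * ((a - b) * D) * r < 0 :=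
          mul_neg_of_neg_of_pos (mul_neg_of_pos_of_neg hn0 hneg) hr
        linarith
      refine ⟨A * 2 ^ n * 2 ^ β * (1 - (2 : ℝ) ^ (n - β))⁻¹ * 2 ^ (n - β), ?_,
        fun Ω hΩ hc R hR => ?_⟩
      · have : (2 : ℝ) ^ (n - β) < 1 :=
          Real.rpow_lt_one_of_one_lt_of_neg (by norm_num) (by linarith)
        have := sub_pos.2 this
        positivity
      · refine (HasPolynomialGrowth.setLIntegral_compl_ball_le hA (hgrowth Ω hΩ hc) hβn
          hR).trans_eq ?_
        rw [Real.mul_rpow zero_le_two hR.le, mul_assoc _ ((2 : ℝ) ^ (n - β))]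
  refine ⟨C * ENNReal.ofReal (K ^ (τ / r)), ENNReal.mul_ne_top hC ENNReal.ofReal_ne_top,
    fun Ω hΩ hc u hu hup R hR => ?_⟩
  refine (h Ω hΩ hc u hu hup _).trans ?_
  have h1 := ENNReal.rpow_le_rpow (z := τ / r) (hweight Ω hΩ hc R hR) (by positivity)
  rw [ENNReal.ofReal_rpow_of_nonneg (by positivity) (by positivity),
    Real.mul_rpow hK (by positivity), ← Real.rpow_mul hR.le, ENNReal.ofReal_mul (by positivity),
    hnβ] at h1
  have h2 : n * ((a - b) * D) * r * (τ / r) = n * ((a - b) * D) * τ := by field_simp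
  have h3 : (γ + b * s) * r = -β := by rw [hβ, neg_neg]
  rw [h2] at h1
  rw [h3]
  refine (mul_le_mul' le_rfl h1).trans_eq ?_
  ring

/-- For weights more singular than `|x|^(-a s)`, the interpolation parameter is increased on one
side of a sphere about the origin and decreased on the other; the radius of the sphere is chosen
according to `u`. -/
theorem interpolationInequality_of_lt_neg_mul (hn : 1 ≤ n) (ha0 : 0 < a) (ha1 : a < 1)
    (hα : 0 < α) (hs : 0 < s) (hs1 : s < 1) (hp : 1 ≤ p) (hq : 1 ≤ q) (hτ : 0 < τ)
    (hsp : s * p < n) (hbal : 1 / τ + γ / n = a * (1 / p - s / n) + (1 - a) / q)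
    (hγs : γ < -(a * s)) (hD : 1 / p - s / n - 1 / q ≠ 0) :
    InterpolationInequality n a α s γ p q τ := by
  have hn0 : (0 : ℝ) < n := by exact_mod_cast hn
  have hp0 : 0 < p := by linarith
  have hq0 : 0 < q := by linarith
  set D : ℝ := 1 / p - s / n - 1 / q with hDdef
  set g : ℝ := -(γ + a * s) with hg
  have hg0 : 0 < g := by rw [hg]; linarith
  have hgap : 1 / τ = a / p + (1 - a) / q + g / n := by
    rw [hg]
    have : a * (1 / p - s / n) = a / p - a * s / n := by ring
    rw [this] at hbal
    have : -(γ + a * s) / n = -(γ / n) - a * s / n := by ring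
    rw [this]
    linarith
  have hpq : |1 / p - 1 / q| ≤ 1 := by
    have h1 : 1 / p ≤ 1 := (div_le_one hp0).2 hp
    have h2 : 1 / q ≤ 1 := (div_le_one hq0).2 hq
    have h3 : 0 < 1 / p := by positivity
    have h4 : 0 < 1 / q := by positivity
    exact abs_le.2 ⟨by linarith, by linarith⟩
  -- how far `a` may be perturbed without losing integrability or the sign of the exponents
  obtain ⟨η, hη0, hηa, hη1, hηg, hηn⟩ :
      ∃ η : ℝ, 0 < η ∧ η < a ∧ η < 1 - a ∧ η < g ∧ η < g / n := by
    have h0 : 0 < min (min a (1 - a)) (min g (g / n)) :=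
      lt_min (lt_min ha0 (sub_pos.2 ha1)) (lt_min hg0 (by positivity))
    obtain ⟨η, hη0, hη⟩ := exists_between h0
    exact ⟨η, hη0, (lt_min_iff.1 (lt_min_iff.1 hη).1).1, (lt_min_iff.1 (lt_min_iff.1 hη).1).2,
      (lt_min_iff.1 (lt_min_iff.1 hη).2).1, (lt_min_iff.1 (lt_min_iff.1 hη).2).2⟩
  have hregion : ∀ b : ℝ, |b - a| = η → ∃ C : ℝ≥0∞, C ≠ ⊤ ∧
      ∀ Ω : Set (EuclideanSpace ℝ (Fin (n + 1))), IsOpen Ω → Convex ℝ Ω →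
      ∀ u : EuclideanSpace ℝ (Fin (n + 1)) → ℝ, Measurable u →
        ∫⁻ x, ENNReal.ofReal (|u x| ^ p) ∂boundaryMeasure Ω ≠ ⊤ → ∀ R : ℝ, 0 < R →
          weightedIntegral ((boundaryMeasure Ω).restrict
              (if 0 < (a - b) * D then Metric.ball 0 R else (Metric.ball 0 R)ᶜ)) γ τ u ≤
            C * (totalEnergy Ω α s p u ^ (b * τ / p) *
              (∫⁻ x, ENNReal.ofReal (|u x| ^ q) ∂boundaryMeasure Ω) ^ ((1 - b) * τ / q) *
              ENNReal.ofReal (R ^ (n * ((a - b) * D) * τ))) := by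
    intro b hb
    have hbs := abs_le.1 hb.le
    have hρ0 : 0 < g / n - (b - a) * (1 / p - 1 / q) := by
      have : |(b - a) * (1 / p - 1 / q)| ≤ η := by
        rw [abs_mul, hb]
        exact mul_le_of_le_one_right hη0.le hpq
      linarith [le_abs_self ((b - a) * (1 / p - 1 / q))]
    set ρ : ℝ := g / n - (b - a) * (1 / p - 1 / q) with hρ
    have hba : (b - a) * s < g := by
      have h1 : (b - a) * s ≤ η * s := by gcongr; exact hbs.2
      have h2 : η * s ≤ η := mul_le_of_le_one_right hη0.le hs1.le
      linarith
    refine exists_weightedIntegral_region_le hn (r := 1 / ρ) (by linarith) (by linarith) hα hs hp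
      hq0 hτ (by positivity) hsp ?_ ?_ ?_ ?_
    · have : γ + b * s = (b - a) * s - g := by rw [hg]; ring
      linarith
    · rw [one_div_one_div, hgap, hρ]
      ring
    · rw [div_div_eq_mul_div, div_one, hρ, hg, hDdef]
      field_simp
      ring
    · refine mul_ne_zero ?_ hD
      intro h0
      rw [abs_sub_comm, h0, abs_zero] at hb
      exact hη0.ne hb
  obtain ⟨bi, hbi, hbiD⟩ : ∃ b, |b - a| = η ∧ 0 < (a - b) * D := by
    rcases lt_or_gt_of_ne hD with h | h
    · exact ⟨a + η, by rw [add_sub_cancel_left, abs_of_pos hη0], by nlinarith⟩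
    · exact ⟨a - η, by rw [sub_sub_cancel_left, abs_neg, abs_of_pos hη0], by nlinarith⟩
  obtain ⟨bo, hbo, hboD⟩ : ∃ b, |b - a| = η ∧ (a - b) * D < 0 := by
    rcases lt_or_gt_of_ne hD with h | h
    · exact ⟨a - η, by rw [sub_sub_cancel_left, abs_neg, abs_of_pos hη0], by nlinarith⟩
    · exact ⟨a + η, by rw [add_sub_cancel_left, abs_of_pos hη0], by nlinarith⟩
  obtain ⟨Ci, hCi, hin⟩ := hregion bi hbi
  obtain ⟨Co, hCo, hout⟩ := hregion bo hbo
  simp only [if_pos hbiD] at hin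
  simp only [if_neg hboD.not_gt] at hout
  have hbi' := abs_le.1 hbi.le
  have hbo' := abs_le.1 hbo.le
  have hexp : ∀ b : ℝ, -η ≤ b - a ∧ b - a ≤ η → 0 < b * τ / p ∧ 0 < (1 - b) * τ / q := by
    rintro b ⟨h1, h2⟩
    have h3 : 0 < b := by linarith
    have h4 : 0 < 1 - b := by linarith
    exact ⟨by positivity, by positivity⟩
  refine ⟨Ci + Co + 1, ENNReal.add_ne_top.2 ⟨ENNReal.add_ne_top.2 ⟨hCi, hCo⟩, by simp⟩,
    fun Ω hΩ hc u hu hup => ?_⟩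
  set E := totalEnergy Ω α s p u with hE
  set L := ∫⁻ x, ENNReal.ofReal (|u x| ^ q) ∂boundaryMeasure Ω with hL
  have hsplit : ∀ R : ℝ, weightedIntegral (boundaryMeasure Ω) γ τ u =
      weightedIntegral ((boundaryMeasure Ω).restrict (Metric.ball 0 R)) γ τ u +
        weightedIntegral ((boundaryMeasure Ω).restrict (Metric.ball 0 R)ᶜ) γ τ u := fun R =>
    (lintegral_add_compl _ measurableSet_ball).symm
  by_cases h0 : E = 0 ∨ L = 0
  · have hz : ∀ b : ℝ, -η ≤ b - a ∧ b - a ≤ η →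
        E ^ (b * τ / p) * L ^ ((1 - b) * τ / q) = 0 := by
      intro b hb
      rcases h0 with h0 | h0
      · rw [h0, ENNReal.zero_rpow_of_pos (hexp b hb).1, zero_mul]
      · rw [h0, ENNReal.zero_rpow_of_pos (hexp b hb).2, mul_zero]
    rw [hsplit 1]
    refine (add_le_add (hin Ω hΩ hc u hu hup 1 one_pos)
      (hout Ω hΩ hc u hu hup 1 one_pos)).trans ?_
    rw [hz bi hbi', hz bo hbo']
    simp
  push Not at h0
  have hexpa := hexp a ⟨by linarith, by linarith⟩
  by_cases htop : E = ⊤ ∨ L = ⊤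
  · refine le_top.trans_eq (Eq.symm ?_)
    have hprod : E ^ (a * τ / p) * L ^ ((1 - a) * τ / q) = ⊤ := by
      rcases htop with h | h
      · rw [h, ENNReal.top_rpow_of_pos hexpa.1, ENNReal.top_mul]
        rw [Ne, ENNReal.rpow_eq_zero_iff]
        rintro (⟨h, -⟩ | ⟨-, h⟩)
        · exact h0.2 h
        · linarith
      · rw [h, ENNReal.top_rpow_of_pos hexpa.2, ENNReal.mul_top]
        rw [Ne, ENNReal.rpow_eq_zero_iff]
        rintro (⟨h, -⟩ | ⟨-, h⟩)
        · exact h0.1 h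
        · linarith
    rw [mul_assoc, hprod, ENNReal.mul_top]
    simp
  push Not at htop
  -- the radius at which the two regions contribute equally
  set e : ℝ := E.toReal ^ (1 / p) with he
  set Q : ℝ := L.toReal ^ (1 / q) with hQ
  have hE0 : 0 < E.toReal := ENNReal.toReal_pos h0.1 htop.1
  have hL0 : 0 < L.toReal := ENNReal.toReal_pos h0.2 htop.2
  have he0 : 0 < e := by positivity
  have hQ0 : 0 < Q := by positivity
  have hEe : ∀ b : ℝ, E ^ (b * τ / p) = ENNReal.ofReal (e ^ (b * τ)) := fun b => by
    rw [he, ← Real.rpow_mul hE0.le, ← ENNReal.ofReal_rpow_of_pos hE0,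
      ENNReal.ofReal_toReal htop.1]
    congr 1
    ring
  have hLQ : ∀ b : ℝ, L ^ ((1 - b) * τ / q) = ENNReal.ofReal (Q ^ ((1 - b) * τ)) := fun b => by
    rw [hQ, ← Real.rpow_mul hL0.le, ← ENNReal.ofReal_rpow_of_pos hL0,
      ENNReal.ofReal_toReal htop.2]
    congr 1
    ring
  set R : ℝ := (e / Q) ^ (1 / (n * D)) with hR
  have hR0 : 0 < R := by positivity
  have hbalance : ∀ b : ℝ, E ^ (b * τ / p) * L ^ ((1 - b) * τ / q) *
      ENNReal.ofReal (R ^ (n * ((a - b) * D) * τ)) =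
      E ^ (a * τ / p) * L ^ ((1 - a) * τ / q) := fun b => by
    rw [hEe, hLQ, hEe, hLQ, ← ENNReal.ofReal_mul (by positivity),
      ← ENNReal.ofReal_mul (by positivity), ← ENNReal.ofReal_mul (by positivity), hR,
      rpow_mul_rpow_mul_radius he0 hQ0 hD hn0.ne']
  have h1 := hin Ω hΩ hc u hu hup R hR0
  have h2 := hout Ω hΩ hc u hu hup R hR0
  rw [hbalance] at h1 h2
  rw [hsplit R]
  calc _ ≤ Ci * (E ^ (a * τ / p) * L ^ ((1 - a) * τ / q)) +
        Co * (E ^ (a * τ / p) * L ^ ((1 - a) * τ / q)) := add_le_add h1 h2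
    _ = (Ci + Co) * (E ^ (a * τ / p) * L ^ ((1 - a) * τ / q)) := by ring
    _ ≤ (Ci + Co + 1) * (E ^ (a * τ / p) * L ^ ((1 - a) * τ / q)) := by
        exact mul_le_mul' le_self_add le_rfl
    _ = _ := by ring

end SingularWeights

/-! ### From integrals to norms -/

section Representatives

variable {n : ℕ} {Ω : Set (EuclideanSpace ℝ (Fin (n + 1)))}
  {u v : EuclideanSpace ℝ (Fin (n + 1)) → ℝ}

theorem totalEnergy_congr (α s p : ℝ) (h : u =ᵐ[boundaryMeasure Ω] v) :
    totalEnergy Ω α s p u = totalEnergy Ω α s p v := by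
  have h1 : gagliardoEnergy Ω s p u = gagliardoEnergy Ω s p v := by
    refine lintegral_congr_ae ?_
    filter_upwards [h] with x hx
    refine lintegral_congr_ae ?_
    filter_upwards [h] with y hy
    rw [hx, hy]
  have h2 : curvatureEnergy Ω α s p u = curvatureEnergy Ω α s p v := by
    refine lintegral_congr_ae ?_
    filter_upwards [h] with x hx
    rw [hx]
  rw [totalEnergy, totalEnergy, h1, h2]

/-- Passage from the inequality between integrals to the one between norms, and to functions that
are measurable only up to null sets. -/
theorem InterpolationInequality.eLpNorm_le {a α s γ p q τ : ℝ} (hp : 1 ≤ p) (hq : 1 ≤ q)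
    (hτ : 0 < τ) (h : InterpolationInequality n a α s γ p q τ) :
    ∃ C : ℝ, 0 < C ∧ ∀ Ω : Set (EuclideanSpace ℝ (Fin (n + 1))), IsOpen Ω → Convex ℝ Ω →
      ∀ u : EuclideanSpace ℝ (Fin (n + 1)) → ℝ,
        MemLp u (ENNReal.ofReal p) (boundaryMeasure Ω) →
        eLpNorm (fun x => ‖x‖ ^ γ * u x) (ENNReal.ofReal τ) (boundaryMeasure Ω) ≤
          ENNReal.ofReal C * totalEnergy Ω α s p u ^ (a / p) *
            eLpNorm u (ENNReal.ofReal q) (boundaryMeasure Ω) ^ (1 - a) := by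
  have hp0 : 0 < p := by linarith
  have hq0 : 0 < q := by linarith
  obtain ⟨C, hC, hmain⟩ := h
  have hCτ : C ^ (1 / τ) ≠ ⊤ := ENNReal.rpow_ne_top_of_nonneg (by positivity) hC
  refine ⟨(C ^ (1 / τ)).toReal + 1, by positivity, fun Ω hΩ hc u hu => ?_⟩
  set v := hu.1.mk u with hv
  have huv : u =ᵐ[boundaryMeasure Ω] v := hu.1.ae_eq_mk
  have hvm : Measurable v := hu.1.stronglyMeasurable_mk.measurable
  have hvp : ∫⁻ x, ENNReal.ofReal (|v x| ^ p) ∂boundaryMeasure Ω ≠ ⊤ := by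
    intro htop
    have h1 := ((memLp_congr_ae huv).1 hu).2
    rw [eLpNorm_eq_rpow_lintegral _ hp0, htop, ENNReal.top_rpow_of_pos (by positivity)] at h1
    exact h1.false
  have huv' : (fun x => ‖x‖ ^ γ * u x) =ᵐ[boundaryMeasure Ω] fun x => ‖x‖ ^ γ * v x := by
    filter_upwards [huv] with x hx
    rw [hx]
  rw [eLpNorm_congr_ae huv', eLpNorm_congr_ae huv, totalEnergy_congr α s p huv,
    eLpNorm_weight_mul_eq _ hτ, eLpNorm_eq_rpow_lintegral _ hq0]
  refine (ENNReal.rpow_le_rpow (hmain Ω hΩ hc v hvm hvp) (by positivity)).trans ?_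
  rw [ENNReal.mul_rpow_of_nonneg _ _ (by positivity),
    ENNReal.mul_rpow_of_nonneg _ _ (by positivity), ← ENNReal.rpow_mul,
    ← ENNReal.rpow_mul, ← ENNReal.rpow_mul]
  have e1 : a * τ / p * (1 / τ) = a / p := by field_simp
  have e2 : (1 - a) * τ / q * (1 / τ) = 1 / q * (1 - a) := by field_simp
  rw [e1, e2]
  gcongr
  rw [← ENNReal.ofReal_toReal hCτ]
  exact ENNReal.ofReal_le_ofReal (by rw [ENNReal.toReal_ofReal (by positivity)]; linarith)

end Representatives

theorem theorem1p1 (n : ℕ) (hn : 1 ≤ n) (a α s γ p q τ pstar : ℝ)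
    (ha : 0 < a ∧ a ≤ 1) (hα : 0 < α ∧ α < 1) (hs : 0 < s ∧ s < 1) (hγ : γ ≤ 0)
    (hp : 1 ≤ p) (hq : 1 ≤ q) (hτ : 0 < τ) (hsp : s * p < n)
    (hpstar : pstar = n * p / (n - s * p))
    (hbal : 1 / τ + γ / n = a / pstar + (1 - a) / q)
    (hγs : a = 1 ∨ q = pstar → -(a * s) ≤ γ) :
    ∃ C : ℝ, 0 < C ∧ ∀ Ω : Set (EuclideanSpace ℝ (Fin (n + 1))), IsOpen Ω → Convex ℝ Ω →
      ∀ u : EuclideanSpace ℝ (Fin (n + 1)) → ℝ, MemFractionalSobolev Ω s p u →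
        eLpNorm (fun x => ‖x‖ ^ γ * u x) (ENNReal.ofReal τ) (boundaryMeasure Ω) ≤
          ENNReal.ofReal C *
            (2⁻¹ * gagliardoEnergy Ω s p u + curvatureEnergy Ω α s p u) ^ (a / p) *
            eLpNorm u (ENNReal.ofReal q) (boundaryMeasure Ω) ^ (1 - a) := by
  have hn0 : (0 : ℝ) < n := by exact_mod_cast hn
  have hp0 : 0 < p := by linarith
  have hstar : 1 / pstar = 1 / p - s / n := by
    have : (n : ℝ) - s * p ≠ 0 := by linarith
    rw [hpstar]
    field_simp
  have hbal' : 1 / τ + γ / n = a * (1 / p - s / n) + (1 - a) / q := by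
    rw [← hstar, hbal]
    ring
  have hineq : InterpolationInequality n a α s γ p q τ := by
    rcases le_or_gt (-(a * s)) γ with h | h
    · exact interpolationInequality_of_neg_mul_le hn ha.1 ha.2 hα.1 hs.1 hγ hp (by linarith) hτ
        hsp hbal' h
    · have hne : ¬(a = 1 ∨ q = pstar) := fun h' => (hγs h').not_gt h
      push Not at hne
      refine interpolationInequality_of_lt_neg_mul hn ha.1 (lt_of_le_of_ne ha.2 hne.1) hα.1 hs.1
        hs.2 hp hq hτ hsp hbal' h ?_
      rw [← hstar, sub_ne_zero]
      intro heq
      rw [one_div, one_div, inv_inj] at heq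
      exact hne.2 heq.symm
  obtain ⟨C, hC, h⟩ := hineq.eLpNorm_le hp hq hτ
  exact ⟨C, hC, fun Ω hΩ hc u hu => h Ω hΩ hc u hu.1⟩
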